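/- Let $n\ge 1$ and let $\mathbb{CP}^n$ be the complex projective space of lines in $\mathbb C^{n+1}$, with its standard complex structure. Then $\mathbb{CP}^n$ admits a unique holomorphic projective connection, namely the standard flat one. In detail: (a) Let $n\ge 2$. A holomorphic projective connection on a complex manifold $M$ of dimension $n\ge 2$ is a collection $(U_i,\nabla_i)_{i\in I}$, where the $U_i$ are open subsets covering $M$ and $\nabla_i$ is a torsionfree holomorphic affine connection on $U_i$ (a holomorphic connection on $TU_i$), such that for all $i,j$ the connections $\nabla_i$ and $\nabla_j$ are projectively equivalent on $U_i\cap U_j$, that is, they have there the same non-parametrized holomorphic geodesics (immersed holomorphic curves $\gamma$ with $\nabla_{\gamma'}\gamma'$ everywhere proportional to $\gamma'$). Two holomorphic projective connections are projectively equivalent if their union is again a holomorphic projective connection, and a holomorphic projective connection is flat if it is projectively equivalent to one all of whose members $\nabla_i$ have zero curvature. For $0\le i\le n$ let $U_i=\{[v_0:\dots:v_n] : v_i\neq 0\}$, and let $\nabla_i$ be the connection on $U_i$ that corresponds to the standard connection of $\mathbb C^n$ under the affine coordinates $(v_k/v_i)_{k\ne i}$. Then $(U_i,\nabla_i)_{0\le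 i\le n}$ is a holomorphic projective connection on $\mathbb{CP}^n$, it is flat, and every holomorphic projective connection on $\mathbb{CP}^n$ is projectively equivalent to it. (b) Let $n=1$. A holomorphic projective connection on a Riemann surface $M$ is a holomorphic projective structure, that is, a collection of holomorphic embeddings $\phi_i:U_i\to\mathbb{CP}^1$ of open subsets covering $M$ such that on each connected component of $U_i\cap U_j$ one has $\phi_i=g\circ\phi_j$ for some $g\in\mathrm{PGL}(2,\mathbb C)$; two of them are equivalent if their union is again a holomorphic projective structure. The identity map of $\mathbb{CP}^1$ is a holomorphic projective structure on $\mathbb{CP}^1$, and every holomorphic projective structure on $\mathbb{CP}^1$ is equivalent to it. -/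

import Mathlib

open scoped Manifold ContDiff Topology Bundle LinearAlgebra.Projectivization MatrixGroups

noncomputable section

/-! ### Complex projective space as a complex manifold -/

/-- Complex projective space: the space of lines in `ℂ^(n+1)`. -/
abbrev CP (n : ℕ) : Type := ℙ ℂ (Fin (n + 1) → ℂ)

namespace CP

/-- The quotient topology from `ℂ^(n+1) ∖ {0}`. -/
instance instTopologicalSpace (n : ℕ) : TopologicalSpace (CP n) :=
  inferInstanceAs
    (TopologicalSpace (Quotient (projectivizationSetoid ℂ (Fin (n + 1) → ℂ))))

variable {n : ℕ}

lemma isQuotientMap_mk' :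
    Topology.IsQuotientMap
      (Projectivization.mk' ℂ : { v : Fin (n + 1) → ℂ // v ≠ 0 } → CP n) :=
  isQuotientMap_quot_mk

/-- The affine coordinates `[v₀ : … : vₙ] ↦ (v_k / v_i)_{k ≠ i}`. -/
def affineCoord (i : Fin (n + 1)) (p : CP n) : Fin n → ℂ :=
  Projectivization.lift
    (fun (v : { v : Fin (n + 1) → ℂ // v ≠ 0 }) (k : Fin n) => v.1 (i.succAbove k) / v.1 i)
    (by
      rintro ⟨a, ha⟩ ⟨b, hb⟩ t h
      simp only at h
      subst h
      have ht : t ≠ 0 := by rintro rfl; simp at ha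
      funext k
      simp only [Pi.smul_apply, smul_eq_mul]
      exact mul_div_mul_left _ _ ht) p

/-- The open set `{[v₀ : … : vₙ] | v_i ≠ 0}`. -/
def affineDomain (i : Fin (n + 1)) : Set (CP n) := {p | p.rep i ≠ 0}

lemma insertNth_ne_zero (i : Fin (n + 1)) (z : Fin n → ℂ) :
    (i.insertNth (1 : ℂ) z : Fin (n + 1) → ℂ) ≠ 0 := by
  intro h
  simpa using congrFun h i

/-- The inverse of the affine coordinates, putting `1` in the `i`-th place. -/
def affineParam (i : Fin (n + 1)) (z : Fin n → ℂ) : CP n :=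
  Projectivization.mk ℂ (i.insertNth (1 : ℂ) z : Fin (n + 1) → ℂ) (insertNth_ne_zero i z)

lemma mk_mem_affineDomain (i : Fin (n + 1)) (v : Fin (n + 1) → ℂ) (hv : v ≠ 0) :
    Projectivization.mk ℂ v hv ∈ affineDomain i ↔ v i ≠ 0 := by
  obtain ⟨a, ha⟩ := Projectivization.exists_smul_eq_mk_rep ℂ v hv
  simp [affineDomain, ← ha, Units.smul_def]

lemma affineCoord_mk (i : Fin (n + 1)) (v : Fin (n + 1) → ℂ) (hv : v ≠ 0) :
    affineCoord i (Projectivization.mk ℂ v hv) = fun k => v (i.succAbove k) / v i := rfl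

lemma isOpen_affineDomain (i : Fin (n + 1)) : IsOpen (affineDomain (n := n) i) := by
  rw [← isQuotientMap_mk'.isOpen_preimage]
  have : (Projectivization.mk' ℂ : { v : Fin (n + 1) → ℂ // v ≠ 0 } → CP n) ⁻¹'
      affineDomain i = {v | v.1 i ≠ 0} := by
    ext v
    simp [mk_mem_affineDomain]
  rw [this]
  exact isOpen_ne.preimage ((continuous_apply i).comp continuous_subtype_val)

lemma continuous_affineParam (i : Fin (n + 1)) : Continuous (affineParam (n := n) i) := by
  have h : Continuous fun z : Fin n → ℂ =>
      (⟨i.insertNth (1 : ℂ) z, insertNth_ne_zero i z⟩ : { v : Fin (n + 1) → ℂ // v ≠ 0 }) := by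
    refine Continuous.subtype_mk ?_ _
    refine continuous_pi fun j => ?_
    refine Fin.succAboveCases i ?_ (fun k => ?_) j
    · simpa using continuous_const
    · simpa using continuous_apply k
  exact isQuotientMap_mk'.continuous.comp h

lemma continuousOn_affineCoord (i : Fin (n + 1)) :
    ContinuousOn (affineCoord (n := n) i) (affineDomain i) := by
  rw [isQuotientMap_mk'.continuousOn_isOpen_iff (isOpen_affineDomain i)]
  refine continuousOn_pi.2 fun k => ?_
  refine ContinuousOn.div ?_ ?_ fun v hv => ?_
  · exact ((continuous_apply _).comp continuous_subtype_val).continuousOn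
  · exact ((continuous_apply _).comp continuous_subtype_val).continuousOn
  · simpa [mk_mem_affineDomain] using hv

/-- The `i`-th standard affine chart. -/
def affineChart (i : Fin (n + 1)) : OpenPartialHomeomorph (CP n) (Fin n → ℂ) where
  toFun := affineCoord i
  invFun := affineParam i
  source := affineDomain i
  target := Set.univ
  map_source' _ _ := Set.mem_univ _
  map_target' z _ := by simp [affineParam, mk_mem_affineDomain]
  left_inv' p hp := by
    induction p using Projectivization.ind with
    | h v hv =>
      rw [mk_mem_affineDomain] at hp
      rw [affineCoord_mk, affineParam, Projectivization.mk_eq_mk_iff']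
      refine ⟨(v i)⁻¹, ?_⟩
      funext j
      refine Fin.succAboveCases i ?_ (fun k => ?_) j
      · simp [hp]
      · simp [div_eq_inv_mul]
  right_inv' z _ := by
    rw [affineParam, affineCoord_mk]
    funext k
    simp
  open_source := isOpen_affineDomain i
  open_target := isOpen_univ
  continuousOn_toFun := continuousOn_affineCoord i
  continuousOn_invFun := (continuous_affineParam i).continuousOn

lemma exists_mem_affineDomain (p : CP n) : ∃ i, p ∈ affineDomain i :=
  Function.ne_iff.1 p.rep_nonzero

/-- The atlas of `CP n` consists of the `n + 1` standard affine charts. -/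
instance instChartedSpace (n : ℕ) : ChartedSpace (Fin n → ℂ) (CP n) where
  atlas := Set.range affineChart
  chartAt p := affineChart (exists_mem_affineDomain p).choose
  mem_chart_source p := (exists_mem_affineDomain p).choose_spec
  chart_mem_atlas _ := Set.mem_range_self _

instance instIsManifold (n : ℕ) : IsManifold 𝓘(ℂ, Fin n → ℂ) ω (CP n) := by
  refine isManifold_of_contDiffOn _ _ _ ?_
  rintro _ _ ⟨i, rfl⟩ ⟨j, rfl⟩
  have hins : ∀ l : Fin (n + 1),
      ContDiff ℂ ω fun z : Fin n → ℂ => (i.insertNth (1 : ℂ) z : Fin (n + 1) → ℂ) l := by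
    intro l
    refine Fin.succAboveCases i ?_ (fun k => ?_) l
    · simpa using contDiff_const
    · simpa using contDiff_apply ℂ ℂ k
  have key : ContDiffOn ℂ ω
      (fun z : Fin n → ℂ => fun k : Fin n =>
        (i.insertNth (1 : ℂ) z : Fin (n + 1) → ℂ) (j.succAbove k) /
          (i.insertNth (1 : ℂ) z : Fin (n + 1) → ℂ) j)
      {z | (i.insertNth (1 : ℂ) z : Fin (n + 1) → ℂ) j ≠ 0} :=
    contDiffOn_pi.2 fun k => (hins _).contDiffOn.div (hins _).contDiffOn fun z hz => hz
  have hsub : ((affineChart i).symm ≫ₕ affineChart j).source ⊆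
      {z | (i.insertNth (1 : ℂ) z : Fin (n + 1) → ℂ) j ≠ 0} := by
    rintro z ⟨-, hz⟩
    have hz' : affineParam i z ∈ affineDomain j := hz
    simpa [affineParam, mk_mem_affineDomain] using hz'
  refine ContDiffOn.congr (key.mono ?_) (fun z _ => rfl)
  intro z hz
  exact hsub (by simpa using hz.1)

end CP

/-! ### Holomorphic projective connections on a complex manifold -/

section ProjectiveConnections

variable (E : Type*) [NormedAddCommGroup E] [NormedSpace ℂ E]
  (M : Type*) [TopologicalSpace M] [ChartedSpace E M]

/-- A vector field on `M`. It need not have any regularity; a field that is only of interest on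
an open set has arbitrary values elsewhere. -/
abbrev VField : Type _ := Π x : M, TangentSpace 𝓘(ℂ, E) x

/-- The type of operators `∇` on vector fields; `∇ Y x (X x)` is `(∇_X Y)(x)`. -/
abbrev ConnOp : Type _ :=
  VField E M → Π x : M, TangentSpace 𝓘(ℂ, E) x →L[ℂ] TangentSpace 𝓘(ℂ, E) x

/-- A subset of `M` together with an operator on vector fields (a candidate for a local
affine connection). Only the behaviour of `cov` over `dom` matters. -/
structure LocalConn where
  /-- the domain -/
  dom : Set M
  /-- the operator -/
  cov : ConnOp E M

variable {E M} [IsManifold 𝓘(ℂ, E) ω M]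

/-- `∇` is a holomorphic connection on the holomorphic tangent bundle of the open set `U`.
Holomorphy is required over all open subsets, since `U` may carry few holomorphic vector fields. -/
structure IsHolAffineConnection (cov : ConnOp E M) (U : Set M) :
    Prop where
  isOpen : IsOpen U
  isCov : IsCovariantDerivativeOn E cov U
  holo : ∀ V : Set M, IsOpen V → V ⊆ U → ContMDiffCovariantDerivativeOn E ω cov V

/-- `∇_X Y - ∇_Y X = [X, Y]` over `U`. -/
def IsTorsionFreeOn (cov : ConnOp E M) (U : Set M) : Prop :=
  ∀ V : Set M, IsOpen V → V ⊆ U → ∀ X Y : VField E M,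
    ContMDiffOn 𝓘(ℂ, E) 𝓘(ℂ, E).tangent ω (T% X) V →
    ContMDiffOn 𝓘(ℂ, E) 𝓘(ℂ, E).tangent ω (T% Y) V →
    ∀ x ∈ V, cov Y x (X x) - cov X x (Y x) = VectorField.mlieBracket 𝓘(ℂ, E) X Y x

/-- `R(X, Y)Z = ∇_X ∇_Y Z - ∇_Y ∇_X Z - ∇_[X,Y] Z`. -/
def curvature (cov : ConnOp E M) (X Y Z : VField E M) (x : M) : TangentSpace 𝓘(ℂ, E) x :=
  cov (fun y => cov Z y (Y y)) x (X x) - cov (fun y => cov Z y (X y)) x (Y x)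
    - cov Z x (VectorField.mlieBracket 𝓘(ℂ, E) X Y x)

/-- The curvature vanishes over `U`. -/
def IsFlatOn (cov : ConnOp E M) (U : Set M) : Prop :=
  ∀ V : Set M, IsOpen V → V ⊆ U → ∀ X Y Z : VField E M,
    ContMDiffOn 𝓘(ℂ, E) 𝓘(ℂ, E).tangent ω (T% X) V →
    ContMDiffOn 𝓘(ℂ, E) 𝓘(ℂ, E).tangent ω (T% Y) V →
    ContMDiffOn 𝓘(ℂ, E) 𝓘(ℂ, E).tangent ω (T% Z) V →
    ∀ x ∈ V, curvature cov X Y Z x = 0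

/-- The velocity of a curve with complex time. -/
def velocity (γ : ℂ → M) (t : ℂ) : TangentSpace 𝓘(ℂ, E) (γ t) :=
  mfderiv 𝓘(ℂ, ℂ) 𝓘(ℂ, E) γ t (1 : ℂ)

/-- The immersed holomorphic curve `γ : D → W` is a non-parametrized geodesic of `∇`:
`∇_{γ'} γ'` is everywhere proportional to `γ'`. The derivative `∇_{γ'} γ'` at time `t` is
computed with a vector field `X`, holomorphic near `γ t`, which extends `γ'`. -/
structure IsNonparamGeodesic (cov : ConnOp E M) (W : Set M) (D : Set ℂ) (γ : ℂ → M) : Prop where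
  isOpen : IsOpen D
  mapsTo : Set.MapsTo γ D W
  holo : ContMDiffOn 𝓘(ℂ, ℂ) 𝓘(ℂ, E) ω γ D
  immersed : ∀ t ∈ D, velocity (E := E) γ t ≠ 0
  geodesic : ∀ t ∈ D, ∃ X : VField E M,
    ContMDiffAt 𝓘(ℂ, E) 𝓘(ℂ, E).tangent ω (T% X) (γ t) ∧
    (∀ᶠ s in 𝓝 t, X (γ s) = velocity γ s) ∧
    ∃ c : ℂ, cov X (γ t) (X (γ t)) = c • X (γ t)

/-- Two connections are projectively equivalent over `W` if they have there the same
non-parametrized holomorphic geodesics. -/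
def ProjEquivOn (cov cov' : ConnOp E M) (W : Set M) : Prop :=
  ∀ (D : Set ℂ) (γ : ℂ → M), IsNonparamGeodesic cov W D γ ↔ IsNonparamGeodesic cov' W D γ

/-- The affine connection on the domain of a chart `e` which corresponds under `e` to the
standard connection (the usual derivative of vector-valued functions) of the model space. -/
def chartConn (e : OpenPartialHomeomorph M E) : ConnOp E M := fun Y x =>
  (mfderiv 𝓘(ℂ, E) 𝓘(ℂ, E) e.symm (e x) : E →L[ℂ] E) ∘L
    (fderiv ℂ (fun z : E =>
      ((mfderiv 𝓘(ℂ, E) 𝓘(ℂ, E) e (e.symm z) : E →L[ℂ] E) (Y (e.symm z)) : E)) (e x)) ∘L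
    (mfderiv 𝓘(ℂ, E) 𝓘(ℂ, E) e x : E →L[ℂ] E)

/-- The collection `S` is a holomorphic projective connection on `M` (of dimension `> 1`). -/
structure IsProjConnection (S : Set (LocalConn E M)) : Prop where
  cover : ⋃ L ∈ S, L.dom = Set.univ
  connection : ∀ L ∈ S, IsHolAffineConnection L.cov L.dom
  torsionFree : ∀ L ∈ S, IsTorsionFreeOn L.cov L.dom
  compatible : ∀ L ∈ S, ∀ L' ∈ S, ProjEquivOn L.cov L'.cov (L.dom ∩ L'.dom)

/-- Two holomorphic projective connections are projectively equivalent if their union is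
a holomorphic projective connection. -/
def ProjConnectionEquiv (S T : Set (LocalConn E M)) : Prop := IsProjConnection (S ∪ T)

/-- A holomorphic projective connection is flat if it is projectively equivalent to one whose
members are flat. -/
def IsFlatProjConnection (S : Set (LocalConn E M)) : Prop :=
  ∃ T : Set (LocalConn E M), IsProjConnection T ∧ (∀ L ∈ T, IsFlatOn L.cov L.dom) ∧
    ProjConnectionEquiv S T

end ProjectiveConnections

/-- The standard flat projective connection of `CP n`: on each affine chart, the standard
connection of `ℂ^n`. -/
def CP.standardProjConnection (n : ℕ) : Set (LocalConn (Fin n → ℂ) (CP n)) :=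
  Set.range fun i : Fin (n + 1) => ⟨(affineChart i).source, chartConn (affineChart i)⟩

/-! ### Holomorphic projective structures (flat projective connections, in any dimension) -/

section ProjectiveStructures

variable {n : ℕ} {M : Type*} [TopologicalSpace M] [ChartedSpace (Fin n → ℂ) M]

/-- The collection `S` of coordinate functions, which are holomorphic embeddings of open subsets
of `M` in `CP n`, is a holomorphic projective structure on `M`: the domains cover `M`, and on
each connected component of an overlap the coordinate functions differ by a projective
transformation. -/
structure IsProjStructure (S : Set (OpenPartialHomeomorph M (CP n))) : Prop where
  cover : ⋃ φ ∈ S, φ.source = Set.univ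
  holo : ∀ φ ∈ S, ContMDiffOn 𝓘(ℂ, Fin n → ℂ) 𝓘(ℂ, Fin n → ℂ) ω φ φ.source
  holo_symm : ∀ φ ∈ S, ContMDiffOn 𝓘(ℂ, Fin n → ℂ) 𝓘(ℂ, Fin n → ℂ) ω φ.symm φ.target
  transition : ∀ φ ∈ S, ∀ ψ ∈ S, ∀ x ∈ φ.source ∩ ψ.source,
    ∃ g : PGL(Fin (n + 1), ℂ), ∀ y ∈ connectedComponentIn (φ.source ∩ ψ.source) x,
      φ y = g • ψ y

/-- Two holomorphic projective structures are equivalent if their union is one. -/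
def ProjStructureEquiv (S T : Set (OpenPartialHomeomorph M (CP n))) : Prop :=
  IsProjStructure (S ∪ T)

end ProjectiveStructures

/-- The standard projective structure of `CP n`, given by the identity map. -/
def CP.standardProjStructure (n : ℕ) : Set (OpenPartialHomeomorph (CP n) (CP n)) :=
  {OpenPartialHomeomorph.refl (CP n)}

end

/-! In both parts, the difference between a given structure and the standard one is a holomorphic
section of a negative bundle on each projective line, hence zero. Concretely, it is an entire
function of an affine parameter that tends to `0` at infinity, and Liouville's theorem applies.

For (a), `projEquivOn_iff` turns equality of geodesics into a pointwise condition: `∇_X X - ∇'_X X`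
is always a multiple of `X`. Passing from geodesics to this condition requires a geodesic in every
direction, hence a holomorphic existence theorem for differential equations. The members of a
projective connection therefore agree on `∇_X X` modulo `X`. For a line with constant velocity `v`
in an affine chart, the class of `∇_v v` modulo `v` is the second fundamental form of the line, a
section of a sum of copies of `O(-4) ⊗ O(1)`. After applying a functional that kills `v` it is an
entire function, and passing to a chart at infinity shows that it decays (`tendsto_secondForm`). So
it vanishes (`secondForm_eq_zero`), and every member agrees with the flat connection of the chart
modulo `X` (`cov_sub_chartConn`). The standard connections are compatible with each other because
changes of affine chart map lines to lines (`chartConn_affineChart_sub`).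

For (b), the invariant is the Schwarzian derivative of a coordinate function in an affine
coordinate. Möbius invariance makes it independent of the member, so it defines a holomorphic
quadratic differential on the projective line. The law `q(z) = q'(1/z) z⁻⁴` forces decay at
infinity, so it is zero (`schwarzian_coordRep_eq_zero`). A function with zero Schwarzian is locally
a Möbius map (`exists_moebius_of_schwarzian_eq_zero`). A projective transformation is determined on
any nonempty open set, so the local transformations agree along each connected component
(`exists_eq_smul_on_component`). -/

/-! ### Holomorphic differential equations by Picard iteration -/

open Metric Set Filter in
/-- **Local existence for holomorphic ordinary differential equations**: an autonomous equation
`u' = F u` in a complex time has a solution with a prescribed initial value. -/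
theorem exists_hasDerivAt_complex_ode {E : Type*} [NormedAddCommGroup E] [NormedSpace ℂ E]
    [CompleteSpace E] {F : E → E} {x₀ : E} (hF : ContDiffAt ℂ 1 F x₀) :
    ∃ r > 0, ∃ u : ℂ → E, u 0 = x₀ ∧ ∀ t ∈ ball (0 : ℂ) r, HasDerivAt u (F (u t)) t := by
  obtain ⟨K, s, hs, hK⟩ := hF.exists_lipschitzOnWith
  have hd : ∀ᶠ x in 𝓝 x₀, DifferentiableAt ℂ F x :=
    (hF.eventually (by simp)).mono fun x hx => hx.differentiableAt one_ne_zero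
  have hb : ∀ᶠ x in 𝓝 x₀, ‖F x‖ < ‖F x₀‖ + 1 :=
    hF.continuousAt.norm.eventually_lt_const (lt_add_one _)
  obtain ⟨R, hR, hball⟩ := nhds_basis_closedBall.mem_iff.1 (inter_mem hs (hd.and hb))
  set C := ‖F x₀‖ + 1 with hC
  have hC0 : 0 < C := by positivity
  have hdiff : ∀ x ∈ closedBall x₀ R, DifferentiableAt ℂ F x := fun x hx => (hball hx).2.1
  have hbd : ∀ x ∈ closedBall x₀ R, ‖F x‖ ≤ C := fun x hx => (hball hx).2.2.le
  have hLip : ∀ x ∈ closedBall x₀ R, ∀ y ∈ closedBall x₀ R, ‖F x - F y‖ ≤ K * ‖x - y‖ :=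
    fun x hx y hy => hK.norm_sub_le (hball hx).1 (hball hy).1
  -- `C * r ≤ R` keeps the iterates in the ball where `F` is controlled; `K * r ≤ 1 / 2` makes the
  -- Picard map contract by one half.
  obtain ⟨r, hr, hrC, hrK⟩ : ∃ r > 0, C * r ≤ R ∧ (K : ℝ) * r ≤ 1 / 2 := by
    refine ⟨min (R / C) (1 / (2 * (K + 1))), by positivity, ?_, ?_⟩
    · calc C * min (R / C) _ ≤ C * (R / C) := by gcongr; exact min_le_left _ _
        _ = R := by field_simp
    · calc (K : ℝ) * min _ (1 / (2 * ((K : ℝ) + 1))) ≤ K * (1 / (2 * ((K : ℝ) + 1))) := by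
            gcongr; exact min_le_right _ _
        _ ≤ 1 / 2 := by
            rw [mul_one_div, div_le_div_iff₀ (by positivity) (by positivity)]
            linarith
  let P : (ℂ → E) → Prop := fun u =>
    DifferentiableOn ℂ u (ball 0 r) ∧ ∀ t ∈ ball (0 : ℂ) r, u t ∈ closedBall x₀ R
  have step : ∀ u, P u → ∃ v, P v ∧ v 0 = x₀ ∧ ∀ t ∈ ball (0 : ℂ) r, HasDerivAt v (F (u t)) t := by
    rintro u ⟨hu, hu'⟩
    have h1 : DifferentiableOn ℂ (fun t => F (u t)) (ball 0 r) := fun t ht =>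
      (hdiff _ (hu' t ht)).comp_differentiableWithinAt t (hu t ht)
    -- A holomorphic function on a disc has a primitive, which plays the role of the integral in the
    -- Picard map.
    obtain ⟨v, hv0, hv⟩ := h1.isExactOn_ball.with_val_at 0 x₀
    refine ⟨v, ⟨fun t ht => (hv t ht).differentiableAt.differentiableWithinAt, fun t ht => ?_⟩,
      hv0, hv⟩
    have := (convex_ball (0 : ℂ) r).norm_image_sub_le_of_norm_hasDerivWithin_le
      (fun t ht => (hv t ht).hasDerivWithinAt) (fun t ht => hbd _ (hu' t ht))
      (mem_ball_self hr) ht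
    rw [hv0] at this
    rw [mem_closedBall, dist_eq_norm]
    refine this.trans (le_trans ?_ hrC)
    gcongr
    simpa using (mem_ball_zero_iff.1 ht).le
  choose! T hTP hT0 hT using step
  let U : ℕ → ℂ → E := fun k => T^[k] (fun _ => x₀)
  have hU : ∀ k, P (U k) := by
    intro k
    induction k with
    | zero => exact ⟨differentiableOn_const _, fun t _ => mem_closedBall_self hR.le⟩
    | succ k ih =>
      simp only [U, Function.iterate_succ_apply']
      exact hTP _ ih
  have hUsucc : ∀ k, U (k + 1) = T (U k) := fun k => Function.iterate_succ_apply' _ _ _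
  have hUd : ∀ k, ∀ t ∈ ball (0 : ℂ) r, HasDerivAt (U (k + 1)) (F (U k t)) t := by
    intro k t ht
    rw [hUsucc]
    exact hT _ (hU k) t ht
  have hU0 : ∀ k, U k 0 = x₀ := by
    intro k
    cases k with
    | zero => rfl
    | succ k => rw [hUsucc]; exact hT0 _ (hU k)
  -- The bound is `R / 2 ^ k`, written in the form `C / 2 / 2 ^ k` that the geometric Cauchy
  -- criterion expects, with `C = 2 * R`.
  have hdist : ∀ k, ∀ t ∈ ball (0 : ℂ) r, dist (U k t) (U (k + 1) t) ≤ 2 * R / 2 / 2 ^ k := by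
    intro k
    induction k with
    | zero =>
      intro t ht
      have := (hU 1).2 t ht
      rw [mem_closedBall, dist_comm] at this
      simpa [U] using this
    | succ k ih =>
      intro t ht
      have h2 := (convex_ball (0 : ℂ) r).norm_image_sub_le_of_norm_hasDerivWithin_le
        (f := fun t => U (k + 1) t - U (k + 1 + 1) t) (C := K * (2 * R / 2 / 2 ^ k))
        (fun t ht => ((hUd k t ht).sub (hUd (k + 1) t ht)).hasDerivWithinAt)
        (fun t ht => (hLip _ ((hU _).2 t ht) _ ((hU _).2 t ht)).trans (by
          have := ih t ht
          rw [dist_eq_norm] at this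
          gcongr)) (mem_ball_self hr) ht
      simp only [hU0, sub_self, sub_zero] at h2
      rw [dist_eq_norm]
      refine h2.trans ?_
      have ht' : ‖t‖ ≤ r := (mem_ball_zero_iff.1 ht).le
      calc K * (2 * R / 2 / 2 ^ k) * ‖t‖ ≤ K * (2 * R / 2 / 2 ^ k) * r := by gcongr
        _ = (K * r) * (2 * R / 2 / 2 ^ k) := by ring
        _ ≤ 1 / 2 * (2 * R / 2 / 2 ^ k) := by gcongr
        _ = 2 * R / 2 / 2 ^ (k + 1) := by rw [pow_succ]; field_simp
  have hlim : ∀ t, ∃ x, t ∈ ball (0 : ℂ) r → Tendsto (fun k => U k t) atTop (𝓝 x) := by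
    intro t
    by_cases ht : t ∈ ball (0 : ℂ) r
    · obtain ⟨x, hx⟩ := cauchySeq_tendsto_of_complete
        (cauchySeq_of_le_geometric_two fun k => hdist k t ht)
      exact ⟨x, fun _ => hx⟩
    · exact ⟨0, fun h => absurd h ht⟩
  choose u hu using hlim
  have hmem : ∀ t ∈ ball (0 : ℂ) r, u t ∈ closedBall x₀ R := fun t ht =>
    isClosed_closedBall.mem_of_tendsto (hu t ht) (Eventually.of_forall fun k => (hU k).2 t ht)
  have hest : ∀ k, ∀ t ∈ ball (0 : ℂ) r, dist (U k t) (u t) ≤ 2 * R / 2 ^ k := fun k t ht =>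
    dist_le_of_le_geometric_two_of_tendsto (fun k => hdist k t ht) (hu t ht) k
  refine ⟨r, hr, u, ?_, fun t ht => ?_⟩
  · refine tendsto_nhds_unique (hu 0 (mem_ball_self hr)) ?_
    simp [hU0]
  -- The derivatives `F (U k t)` converge uniformly because `F` is Lipschitz, so the differential
  -- equation passes to the limit.
  · refine hasDerivAt_of_tendstoUniformlyOn (l := atTop) (f := fun k => U (k + 1))
      (f' := fun k t => F (U k t)) (g' := fun t => F (u t)) isOpen_ball ?_
      (Eventually.of_forall hUd) (fun t ht => (hu t ht).comp (tendsto_add_atTop_nat 1)) ht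
    rw [Metric.tendstoUniformlyOn_iff]
    intro ε hε
    have hgeo : Tendsto (fun k : ℕ => (K : ℝ) * (2 * R / 2 ^ k)) atTop (𝓝 0) := by
      have := (tendsto_pow_atTop_nhds_zero_of_lt_one (r := (1 / 2 : ℝ)) (by norm_num)
        (by norm_num)).const_mul ((K : ℝ) * (2 * R))
      simp only [mul_zero] at this
      refine this.congr fun k => ?_
      rw [one_div, inv_pow]
      ring
    filter_upwards [hgeo.eventually_lt_const hε] with k hk t ht
    rw [dist_comm, dist_eq_norm]
    refine (hLip _ ((hU k).2 t ht) _ (hmem t ht)).trans_lt (lt_of_le_of_lt ?_ hk)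
    have := hest k t ht
    rw [dist_eq_norm] at this
    gcongr

/-! ### Vector fields and Lie brackets in a chart -/

section ChartCalculus

open Filter VectorField

variable {E : Type*} [NormedAddCommGroup E] [NormedSpace ℂ E]
  {M : Type*} [TopologicalSpace M] [ChartedSpace E M]

/-- The derivative of a chart, with values in the model space. -/
noncomputable def dChart (e : OpenPartialHomeomorph M E) (p : M) :
    TangentSpace 𝓘(ℂ, E) p →L[ℂ] E :=
  mfderiv 𝓘(ℂ, E) 𝓘(ℂ, E) e p

/-- The derivative of the inverse of a chart, at the image of `p`. -/
noncomputable def dChartSymm (e : OpenPartialHomeomorph M E) (p : M) :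
    E →L[ℂ] TangentSpace 𝓘(ℂ, E) p :=
  (mfderiv 𝓘(ℂ, E) 𝓘(ℂ, E) e.symm (e p) : E →L[ℂ] E)

/-- The expression of a vector field in a chart. -/
noncomputable def chartRep (e : OpenPartialHomeomorph M E) (Y : VField E M) (z : E) : E :=
  dChart e (e.symm z) (Y (e.symm z))

/-- The vector field with a given expression in a chart. -/
noncomputable def chartField (e : OpenPartialHomeomorph M E) (F : E → E) : VField E M :=
  fun p => dChartSymm e p (F (e p))

variable {e : OpenPartialHomeomorph M E}

lemma mdifferentiable_of_mem_maximalAtlas (he : e ∈ IsManifold.maximalAtlas 𝓘(ℂ, E) ω M) :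
    e.MDifferentiable 𝓘(ℂ, E) 𝓘(ℂ, E) :=
  ⟨(contMDiffOn_of_mem_maximalAtlas he).mdifferentiableOn (by simp),
    (contMDiffOn_symm_of_mem_maximalAtlas he).mdifferentiableOn (by simp)⟩

lemma dChartSymm_dChart (he : e ∈ IsManifold.maximalAtlas 𝓘(ℂ, E) ω M) {p : M}
    (hp : p ∈ e.source) (v : TangentSpace 𝓘(ℂ, E) p) : dChartSymm e p (dChart e p v) = v :=
  congrArg (fun L : E →L[ℂ] E => L v)
    ((mdifferentiable_of_mem_maximalAtlas he).symm_comp_deriv hp)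

lemma dChart_dChartSymm (he : e ∈ IsManifold.maximalAtlas 𝓘(ℂ, E) ω M) {p : M}
    (hp : p ∈ e.source) (v : E) : dChart e p (dChartSymm e p v) = v := by
  have := congrArg (fun L : E →L[ℂ] E => L v)
    ((mdifferentiable_of_mem_maximalAtlas he).comp_symm_deriv (e.map_source hp))
  rw [e.left_inv hp] at this
  exact this

/-- The derivative of a chart as a linear equivalence. -/
noncomputable def dChartEquiv (he : e ∈ IsManifold.maximalAtlas 𝓘(ℂ, E) ω M) {p : M}
    (hp : p ∈ e.source) : TangentSpace 𝓘(ℂ, E) p ≃L[ℂ] E :=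
  ContinuousLinearEquiv.equivOfInverse (dChart e p) (dChartSymm e p)
    (dChartSymm_dChart he hp) (dChart_dChartSymm he hp)

lemma isInvertible_mfderiv_chart (he : e ∈ IsManifold.maximalAtlas 𝓘(ℂ, E) ω M) {p : M}
    (hp : p ∈ e.source) : (mfderiv 𝓘(ℂ, E) 𝓘(ℂ, E) e p).IsInvertible :=
  ⟨dChartEquiv he hp, rfl⟩

lemma isInvertible_mfderiv_chart_symm (he : e ∈ IsManifold.maximalAtlas 𝓘(ℂ, E) ω M) {p : M}
    (hp : p ∈ e.source) : (mfderiv 𝓘(ℂ, E) 𝓘(ℂ, E) e.symm (e p)).IsInvertible :=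
  ⟨(dChartEquiv he hp).symm, rfl⟩

lemma mpullback_chart (he : e ∈ IsManifold.maximalAtlas 𝓘(ℂ, E) ω M) {p : M}
    (hp : p ∈ e.source) (F : Π z : E, TangentSpace 𝓘(ℂ, E) z) :
    mpullback 𝓘(ℂ, E) 𝓘(ℂ, E) e F p = chartField e F p :=
  congrArg (fun L : E →L[ℂ] TangentSpace 𝓘(ℂ, E) p => L (F (e p)))
    (ContinuousLinearMap.inverse_equiv (dChartEquiv he hp))

lemma chartRep_apply {p : M} (hp : p ∈ e.source) (Y : VField E M) :
    chartRep e Y (e p) = dChart e p (Y p) := by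
  unfold chartRep
  rw [e.left_inv hp]

lemma mpullback_chart_symm (he : e ∈ IsManifold.maximalAtlas 𝓘(ℂ, E) ω M) {p : M}
    (hp : p ∈ e.source) (Y : VField E M) :
    mpullback 𝓘(ℂ, E) 𝓘(ℂ, E) e.symm Y (e p) = chartRep e Y (e p) := by
  rw [chartRep_apply hp]
  have h2 := congrArg (fun L : TangentSpace 𝓘(ℂ, E) p →L[ℂ] E => L (Y p))
    (ContinuousLinearMap.inverse_equiv (dChartEquiv he hp).symm)
  refine Eq.trans ?_ h2
  rw [mpullback_apply]
  change ContinuousLinearMap.inverse (dChartSymm e p : E →L[ℂ] E) (Y (e.symm (e p)) : E) = _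
  rw [e.left_inv hp]
  rfl

lemma mpullback_chart_symm_eventuallyEq (he : e ∈ IsManifold.maximalAtlas 𝓘(ℂ, E) ω M) {p : M}
    (hp : p ∈ e.source) (Y : VField E M) :
    ∀ᶠ z in 𝓝 (e p), mpullback 𝓘(ℂ, E) 𝓘(ℂ, E) e.symm Y z = chartRep e Y z := by
  filter_upwards [e.open_target.mem_nhds (e.map_source hp)] with z hz
  have := mpullback_chart_symm he (e.map_target hz) Y
  rwa [e.right_inv hz] at this

lemma chartField_chartRep (he : e ∈ IsManifold.maximalAtlas 𝓘(ℂ, E) ω M) {p : M}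
    (hp : p ∈ e.source) (Y : VField E M) : chartField e (chartRep e Y) p = Y p := by
  unfold chartField
  rw [chartRep_apply hp, dChartSymm_dChart he hp]

lemma chartRep_chartField (he : e ∈ IsManifold.maximalAtlas 𝓘(ℂ, E) ω M) {z : E}
    (hz : z ∈ e.target) (F : E → E) : chartRep e (chartField e F) z = F z := by
  have := chartRep_apply (e.map_target hz) (chartField e F)
  rw [e.right_inv hz] at this
  rw [this, chartField, dChart_dChartSymm he (e.map_target hz), e.right_inv hz]

lemma chartRep_chartField_eventuallyEq (he : e ∈ IsManifold.maximalAtlas 𝓘(ℂ, E) ω M) {z : E}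
    (hz : z ∈ e.target) (F : E → E) : chartRep e (chartField e F) =ᶠ[𝓝 z] F := by
  filter_upwards [e.open_target.mem_nhds hz] with w hw using chartRep_chartField he hw F

lemma mpullback_chart_chartRep_eventuallyEq (he : e ∈ IsManifold.maximalAtlas 𝓘(ℂ, E) ω M)
    {p : M} (hp : p ∈ e.source) (Y : VField E M) :
    ∀ᶠ q in 𝓝 p, mpullback 𝓘(ℂ, E) 𝓘(ℂ, E) e (chartRep e Y : Π z : E, TangentSpace 𝓘(ℂ, E) z) q
      = Y q := by
  filter_upwards [e.open_source.mem_nhds hp] with q hq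
  exact (mpullback_chart he hq _).trans (chartField_chartRep he hq Y)

lemma mdifferentiableAt_vectorSpace_iff {F : Π z : E, TangentSpace 𝓘(ℂ, E) z} {z : E} :
    MDifferentiableAt 𝓘(ℂ, E) 𝓘(ℂ, E).tangent (T% F) z ↔ DifferentiableAt ℂ (F : E → E) z := by
  refine ⟨fun h => ?_, fun h => ?_⟩
  · exact mdifferentiableAt_iff_differentiableAt.1
      (((contMDiff_snd_tangentBundle_modelSpace E 𝓘(ℂ, E) (n := 1)).mdifferentiable
        one_ne_zero).mdifferentiableAt.comp z h)
  · apply (mdifferentiableAt_totalSpace ..).2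
    refine ⟨mdifferentiableAt_id, ?_⟩
    convert! h.mdifferentiableAt with y
    simp

lemma mlieBracket_vectorSpace (V W : Π z : E, TangentSpace 𝓘(ℂ, E) z) (z : E) :
    mlieBracket 𝓘(ℂ, E) V W z = fderiv ℂ (W : E → E) z (V z) - fderiv ℂ (V : E → E) z (W z) := by
  rw [← mlieBracketWithin_univ, mlieBracketWithin_eq_lieBracketWithin]
  exact congrFun (lieBracketWithin_univ (𝕜 := ℂ) (V := (V : E → E)) (W := (W : E → E))) z

variable [IsManifold 𝓘(ℂ, E) ω M] [CompleteSpace E]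

/-- Near `p`, a field and its expression in the chart are pullbacks of one another along the chart
and its inverse, and pullback preserves holomorphy. This reduces questions about sections of the
tangent bundle to vector-valued functions. -/
lemma contMDiffAt_iff_chartRep (he : e ∈ IsManifold.maximalAtlas 𝓘(ℂ, E) ω M) {p : M}
    (hp : p ∈ e.source) {Y : VField E M} :
    ContMDiffAt 𝓘(ℂ, E) 𝓘(ℂ, E).tangent ω (T% Y) p ↔ ContDiffAt ℂ ω (chartRep e Y) (e p) := by
  constructor
  · intro h
    have h1 : ContMDiffAt 𝓘(ℂ, E) 𝓘(ℂ, E).tangent ω (T% Y) (e.symm (e p)) := by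
      rwa [e.left_inv hp]
    have h2 := h1.mpullback_vectorField_preimage
      (contMDiffAt_symm_of_mem_maximalAtlas he (e.map_source hp))
      (isInvertible_mfderiv_chart_symm he hp) (by simp)
    refine (contMDiffAt_vectorSpace_iff_contDiffAt.1 h2).congr_of_eventuallyEq ?_
    filter_upwards [mpullback_chart_symm_eventuallyEq he hp Y] with z hz using hz.symm
  · intro h
    have h2 := (contMDiffAt_vectorSpace_iff_contDiffAt
      (V := (chartRep e Y : Π z : E, TangentSpace 𝓘(ℂ, E) z)).2 h).mpullback_vectorField_preimage
      (contMDiffAt_of_mem_maximalAtlas he hp) (isInvertible_mfderiv_chart he hp) (by simp)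
    refine h2.congr_of_eventuallyEq ?_
    filter_upwards [mpullback_chart_chartRep_eventuallyEq he hp Y] with q hq
    rw [hq]

lemma mdifferentiableAt_iff_chartRep (he : e ∈ IsManifold.maximalAtlas 𝓘(ℂ, E) ω M) {p : M}
    (hp : p ∈ e.source) {Y : VField E M} :
    MDifferentiableAt 𝓘(ℂ, E) 𝓘(ℂ, E).tangent (T% Y) p ↔
      DifferentiableAt ℂ (chartRep e Y) (e p) := by
  constructor
  · intro h
    have h1 : MDifferentiableAt 𝓘(ℂ, E) 𝓘(ℂ, E).tangent (T% Y) (e.symm (e p)) := by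
      rwa [e.left_inv hp]
    have h2 := h1.mpullback_vectorField
      (contMDiffAt_symm_of_mem_maximalAtlas he (e.map_source hp))
      (isInvertible_mfderiv_chart_symm he hp) (by simp)
    refine (mdifferentiableAt_vectorSpace_iff.1 h2).congr_of_eventuallyEq ?_
    filter_upwards [mpullback_chart_symm_eventuallyEq he hp Y] with z hz using hz.symm
  · intro h
    have h2 := (mdifferentiableAt_vectorSpace_iff
      (F := (chartRep e Y : Π z : E, TangentSpace 𝓘(ℂ, E) z)).2 h).mpullback_vectorField
      (contMDiffAt_of_mem_maximalAtlas he hp) (isInvertible_mfderiv_chart he hp) (by simp)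
    refine h2.congr_of_eventuallyEq ?_
    filter_upwards [mpullback_chart_chartRep_eventuallyEq he hp Y] with q hq
    rw [hq]

lemma contMDiffAt_chartField (he : e ∈ IsManifold.maximalAtlas 𝓘(ℂ, E) ω M) {p : M}
    (hp : p ∈ e.source) {F : E → E} (hF : ContDiffAt ℂ ω F (e p)) :
    ContMDiffAt 𝓘(ℂ, E) 𝓘(ℂ, E).tangent ω (T% (chartField e F)) p :=
  (contMDiffAt_iff_chartRep he hp).2 (hF.congr_of_eventuallyEq
    (chartRep_chartField_eventuallyEq he (e.map_source hp) F))

/-- Naturality of the Lie bracket under pullback by the inverse chart, followed by the bracket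
formula in a vector space. -/
lemma dChart_mlieBracket (he : e ∈ IsManifold.maximalAtlas 𝓘(ℂ, E) ω M) {p : M}
    (hp : p ∈ e.source) {X Y : VField E M}
    (hX : MDifferentiableAt 𝓘(ℂ, E) 𝓘(ℂ, E).tangent (T% X) p)
    (hY : MDifferentiableAt 𝓘(ℂ, E) 𝓘(ℂ, E).tangent (T% Y) p) :
    dChart e p (mlieBracket 𝓘(ℂ, E) X Y p) =
      fderiv ℂ (chartRep e Y) (e p) (chartRep e X (e p)) -
        fderiv ℂ (chartRep e X) (e p) (chartRep e Y (e p)) := by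
  rw [← chartRep_apply hp, ← mpullback_chart_symm he hp]
  rw [← e.left_inv hp] at hX hY
  rw [mpullback_mlieBracket hX hY (contMDiffAt_symm_of_mem_maximalAtlas he (e.map_source hp))
    (by simp [minSmoothness_of_isRCLikeNormedField])]
  rw [Filter.EventuallyEq.mlieBracket_vectorField_eq
    (V := (chartRep e X : Π z : E, TangentSpace 𝓘(ℂ, E) z))
    (W := (chartRep e Y : Π z : E, TangentSpace 𝓘(ℂ, E) z))
    (mpullback_chart_symm_eventuallyEq he hp X)
    (mpullback_chart_symm_eventuallyEq he hp Y)]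
  exact mlieBracket_vectorSpace _ _ _

end ChartCalculus

/-! ### The flat connection of a chart -/

section ChartConnection

open Filter VectorField

variable {E : Type*} [NormedAddCommGroup E] [NormedSpace ℂ E]
  {M : Type*} [TopologicalSpace M] [ChartedSpace E M] {e : OpenPartialHomeomorph M E}

lemma chartConn_apply (e : OpenPartialHomeomorph M E) (Y : VField E M) (p : M)
    (v : TangentSpace 𝓘(ℂ, E) p) :
    chartConn e Y p v = dChartSymm e p (fderiv ℂ (chartRep e Y) (e p) (dChart e p v)) := rfl

lemma dChart_chartConn (he : e ∈ IsManifold.maximalAtlas 𝓘(ℂ, E) ω M) {p : M}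
    (hp : p ∈ e.source) (Y : VField E M) (v : TangentSpace 𝓘(ℂ, E) p) :
    dChart e p (chartConn e Y p v) = fderiv ℂ (chartRep e Y) (e p) (dChart e p v) := by
  rw [chartConn_apply, dChart_dChartSymm he hp]

lemma dChart_injective (he : e ∈ IsManifold.maximalAtlas 𝓘(ℂ, E) ω M) {p : M}
    (hp : p ∈ e.source) : Function.Injective (dChart e p) :=
  Function.LeftInverse.injective (dChartSymm_dChart he hp)

lemma chartRep_chartConn (he : e ∈ IsManifold.maximalAtlas 𝓘(ℂ, E) ω M) {z : E}
    (hz : z ∈ e.target) (X Y : VField E M) :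
    chartRep e (fun q => chartConn e Y q (X q)) z =
      fderiv ℂ (chartRep e Y) z (chartRep e X z) := by
  have h := dChart_chartConn he (e.map_target hz) Y (X (e.symm z))
  rwa [e.right_inv hz] at h

lemma hasFDerivAt_comp_chart_symm (he : e ∈ IsManifold.maximalAtlas 𝓘(ℂ, E) ω M) {p : M}
    (hp : p ∈ e.source) {F : Type*} [NormedAddCommGroup F] [NormedSpace ℂ F] {g : M → F}
    (hg : MDifferentiableAt 𝓘(ℂ, E) 𝓘(ℂ, F) g p) :
    HasFDerivAt (fun z => g (e.symm z))
      (mvfderiv 𝓘(ℂ, E) g p ∘L dChartSymm e p)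
      (e p) := by
  have h1 : HasMFDerivAt 𝓘(ℂ, E) 𝓘(ℂ, F) g (e.symm (e p))
      (mfderiv 𝓘(ℂ, E) 𝓘(ℂ, F) g p : E →L[ℂ] F) := by
    rw [e.left_inv hp]
    exact hg.hasMFDerivAt
  have h2 := ((mdifferentiable_of_mem_maximalAtlas he).mdifferentiableAt_symm
    (e.map_source hp)).hasMFDerivAt
  exact (HasMFDerivAt.comp (e p) h1 h2).hasFDerivAt

variable [IsManifold 𝓘(ℂ, E) ω M] [CompleteSpace E]

lemma isCovariantDerivativeOn_chartConn (he : e ∈ IsManifold.maximalAtlas 𝓘(ℂ, E) ω M) :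
    IsCovariantDerivativeOn E (chartConn e) e.source where
  add {σ σ' p} hσ hσ' hp := by
    ext v
    apply dChart_injective he hp
    have h : chartRep e (σ + σ') = chartRep e σ + chartRep e σ' := by
      ext z; simp [chartRep]
    rw [add_apply, map_add, dChart_chartConn he hp, dChart_chartConn he hp,
      dChart_chartConn he hp, h, fderiv_add ((mdifferentiableAt_iff_chartRep he hp).1 hσ)
        ((mdifferentiableAt_iff_chartRep he hp).1 hσ')]
    rfl
  leibniz {σ g p} hσ hg hp := by
    ext v
    apply dChart_injective he hp
    have h : chartRep e (g • σ) = (fun z => g (e.symm z)) • chartRep e σ := by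
      ext z; simp [chartRep]
    have hg' := hasFDerivAt_comp_chart_symm he hp hg
    rw [dChart_chartConn he hp, h,
      (hg'.smul ((mdifferentiableAt_iff_chartRep he hp).1 hσ).hasFDerivAt).fderiv]
    simp only [add_apply, smul_apply, map_add, map_smul,
      dChart_chartConn he hp, ContinuousLinearMap.smulRight_apply, chartRep_apply hp,
      ContinuousLinearMap.comp_apply, dChartSymm_dChart he hp, e.left_inv hp]

lemma isTorsionFreeOn_chartConn (he : e ∈ IsManifold.maximalAtlas 𝓘(ℂ, E) ω M) :
    IsTorsionFreeOn (chartConn e) e.source := by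
  intro V hV hVe X Y hX hY p hp
  have hpe := hVe hp
  apply dChart_injective he hpe
  rw [map_sub, dChart_chartConn he hpe, dChart_chartConn he hpe,
    dChart_mlieBracket he hpe
      ((hX.contMDiffAt (hV.mem_nhds hp)).mdifferentiableAt (by simp))
      ((hY.contMDiffAt (hV.mem_nhds hp)).mdifferentiableAt (by simp)),
    chartRep_apply hpe, chartRep_apply hpe]

omit [IsManifold 𝓘(ℂ, E) ω M] [CompleteSpace E] in
lemma fderiv_chartRep_chartConn (he : e ∈ IsManifold.maximalAtlas 𝓘(ℂ, E) ω M) {p : M}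
    (hp : p ∈ e.source) {X Y : VField E M} (hX : ContDiffAt ℂ ω (chartRep e X) (e p))
    (hY : ContDiffAt ℂ ω (chartRep e Y) (e p)) (v : E) :
    fderiv ℂ (chartRep e (fun q => chartConn e Y q (X q))) (e p) v =
      fderiv ℂ (fderiv ℂ (chartRep e Y)) (e p) v (chartRep e X (e p)) +
        fderiv ℂ (chartRep e Y) (e p) (fderiv ℂ (chartRep e X) (e p) v) := by
  have h : chartRep e (fun q => chartConn e Y q (X q)) =ᶠ[𝓝 (e p)]
      fun z => fderiv ℂ (chartRep e Y) z (chartRep e X z) := by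
    filter_upwards [e.open_target.mem_nhds (e.map_source hp)] with z hz
    exact chartRep_chartConn he hz X Y
  rw [h.fderiv_eq, fderiv_clm_apply
    ((hY.fderiv_right (m := 1) (by simp)).differentiableAt one_ne_zero)
    (hX.differentiableAt (by simp))]
  simp [add_comm]

/-- In the chart, the second derivatives of `Z` cancel by symmetry, and the remaining first-order
terms are exactly the derivative of `Z` along `[X, Y]`. -/
lemma isFlatOn_chartConn (he : e ∈ IsManifold.maximalAtlas 𝓘(ℂ, E) ω M) :
    IsFlatOn (chartConn e) e.source := by
  intro V hV hVe X Y Z hX hY hZ p hp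
  have hpe := hVe hp
  have hX' := hX.contMDiffAt (hV.mem_nhds hp)
  have hY' := hY.contMDiffAt (hV.mem_nhds hp)
  have hZ' := (contMDiffAt_iff_chartRep he hpe).1 (hZ.contMDiffAt (hV.mem_nhds hp))
  apply dChart_injective he hpe
  have hsymm : IsSymmSndFDerivAt ℂ (chartRep e Z) (e p) :=
    hZ'.isSymmSndFDerivAt (by simp)
  rw [curvature, map_sub, map_sub, dChart_chartConn he hpe, dChart_chartConn he hpe,
    dChart_chartConn he hpe,
    dChart_mlieBracket he hpe (hX'.mdifferentiableAt (by simp)) (hY'.mdifferentiableAt (by simp)),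
    fderiv_chartRep_chartConn he hpe ((contMDiffAt_iff_chartRep he hpe).1 hY') hZ',
    fderiv_chartRep_chartConn he hpe ((contMDiffAt_iff_chartRep he hpe).1 hX') hZ',
    chartRep_apply hpe, chartRep_apply hpe, hsymm.eq, map_sub, map_zero]
  abel

lemma contMDiffAt_chartConn_apply (he : e ∈ IsManifold.maximalAtlas 𝓘(ℂ, E) ω M) {p : M}
    (hp : p ∈ e.source) {X Y : VField E M}
    (hX : ContMDiffAt 𝓘(ℂ, E) 𝓘(ℂ, E).tangent ω (T% X) p)
    (hY : ContMDiffAt 𝓘(ℂ, E) 𝓘(ℂ, E).tangent ω (T% Y) p) :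
    ContMDiffAt 𝓘(ℂ, E) 𝓘(ℂ, E).tangent ω (T% (fun q => chartConn e Y q (X q))) p := by
  rw [contMDiffAt_iff_chartRep he hp] at hX hY ⊢
  have h : ContDiffAt ℂ ω (fun z => fderiv ℂ (chartRep e Y) z (chartRep e X z)) (e p) :=
    (hY.fderiv_right (m := ω) (by simp)).clm_apply hX
  refine h.congr_of_eventuallyEq ?_
  filter_upwards [e.open_target.mem_nhds (e.map_source hp)] with z hz
  exact chartRep_chartConn he hz X Y

omit [IsManifold 𝓘(ℂ, E) ω M] [CompleteSpace E] in
lemma contMDiffAt_clm_of_apply [FiniteDimensional ℂ E] {F : Type*} [NormedAddCommGroup F]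
    [NormedSpace ℂ F] {f : M → E →L[ℂ] F} {p : M}
    (h : ∀ v, ContMDiffAt 𝓘(ℂ, E) 𝓘(ℂ, F) ω (fun x => f x v) p) :
    ContMDiffAt 𝓘(ℂ, E) 𝓘(ℂ, E →L[ℂ] F) ω f p := by
  let b := Module.finBasis ℂ E
  have hf : f = fun x => ∑ i, (ContinuousLinearMap.smulRightL ℂ E F
      (LinearMap.toContinuousLinearMap (b.coord i))) (f x (b i)) := by
    ext x v
    calc f x v = f x (∑ i, b.repr v i • b i) := by rw [b.sum_repr]
      _ = ∑ i, b.repr v i • f x (b i) := by rw [map_sum]; simp only [map_smul]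
      _ = _ := by simp
  rw [hf]
  refine contMDiffAt_finsetSum fun i _ => ?_
  exact (ContinuousLinearMap.contMDiff _).contMDiffAt.comp p (h (b i))

omit [CompleteSpace E] in
/-- A section of the bundle of endomorphisms of the tangent bundle is holomorphic if its values
on holomorphic vector fields are. -/
lemma contMDiffAt_endomorphism_of_apply [FiniteDimensional ℂ E] {p : M}
    {A : Π x : M, TangentSpace 𝓘(ℂ, E) x →L[ℂ] TangentSpace 𝓘(ℂ, E) x}
    (h : ∀ X : VField E M, ContMDiffAt 𝓘(ℂ, E) 𝓘(ℂ, E).tangent ω (T% X) p →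
      ContMDiffAt 𝓘(ℂ, E) 𝓘(ℂ, E).tangent ω (T% (fun q => A q (X q))) p) :
    ContMDiffAt 𝓘(ℂ, E) (𝓘(ℂ, E).prod 𝓘(ℂ, E →L[ℂ] E)) ω
      (fun x => (⟨x, A x⟩ : Bundle.TotalSpace (E →L[ℂ] E)
        fun x => TangentSpace 𝓘(ℂ, E) x →L[ℂ] TangentSpace 𝓘(ℂ, E) x)) p := by
  rw [contMDiffAt_hom_bundle]
  refine ⟨contMDiffAt_id, contMDiffAt_clm_of_apply fun v => ?_⟩
  set t := trivializationAt E (TangentSpace 𝓘(ℂ, E) : M → Type _) p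
  have hp : p ∈ t.baseSet := FiberBundle.mem_baseSet_trivializationAt' p
  -- The test field is constant with value `v` in the trivialization at `p`, so evaluating `A` on it
  -- gives the local expression of `A` at `v`.
  have hX : ContMDiffAt 𝓘(ℂ, E) 𝓘(ℂ, E).tangent ω
      (T% (fun q => t.symmL ℂ q v : VField E M)) p := by
    rw [Bundle.contMDiffAt_section]
    refine contMDiffAt_const (c := v) |>.congr_of_eventuallyEq ?_
    filter_upwards [t.open_baseSet.mem_nhds hp] with q hq
    have h1 := t.continuousLinearMapAt_symmL (R := ℂ) hq v
    rwa [Bundle.Trivialization.continuousLinearMapAt_apply, Bundle.Trivialization.linearMapAt_apply,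
      if_pos hq] at h1
  have h2 := (Bundle.contMDiffAt_section _).1 (h _ hX)
  refine h2.congr_of_eventuallyEq ?_
  filter_upwards [t.open_baseSet.mem_nhds hp] with q hq
  have h1 := t.linearMapAt_apply (R := ℂ) (b := q) (A q (t.symmL ℂ q v))
  rw [if_pos hq] at h1
  exact h1

lemma isHolAffineConnection_chartConn [FiniteDimensional ℂ E]
    (he : e ∈ IsManifold.maximalAtlas 𝓘(ℂ, E) ω M) :
    IsHolAffineConnection (chartConn e) e.source where
  isOpen := e.open_source
  isCov := isCovariantDerivativeOn_chartConn he
  holo _ hV hVe := ⟨fun hσ _ hp => ContMDiffAt.contMDiffWithinAt <|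
    contMDiffAt_endomorphism_of_apply fun _ hX =>
      contMDiffAt_chartConn_apply he (hVe hp) hX (hσ.contMDiffAt (hV.mem_nhds hp))⟩

end ChartConnection

/-! ### Christoffel symbols -/

section Christoffel

open Filter VectorField Set

variable {E : Type*} [NormedAddCommGroup E] [NormedSpace ℂ E]
  {M : Type*} [TopologicalSpace M] [ChartedSpace E M] {e : OpenPartialHomeomorph M E}

lemma velocity_chart_symm_comp (he : e ∈ IsManifold.maximalAtlas 𝓘(ℂ, E) ω M) {a : ℂ → E} {a' : E}
    {t : ℂ} (ht : a t ∈ e.target) (ha : HasDerivAt a a' t) :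
    velocity (E := E) (fun s => e.symm (a s)) t = dChartSymm e (e.symm (a t)) a' := by
  have h1 : HasMFDerivAt 𝓘(ℂ, ℂ) 𝓘(ℂ, E) a t
      ((ContinuousLinearMap.smulRight (1 : ℂ →L[ℂ] ℂ) a' : ℂ →L[ℂ] E)) :=
    ha.hasFDerivAt.hasMFDerivAt
  have h2 := ((mdifferentiable_of_mem_maximalAtlas he).mdifferentiableAt_symm ht).hasMFDerivAt
  have h3 := (HasMFDerivAt.comp t h2 h1).mfderiv
  unfold velocity dChartSymm
  rw [e.right_inv ht]
  refine (congrArg (fun L : ℂ →L[ℂ] E => L 1) h3).trans ?_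
  exact congrArg (mfderiv 𝓘(ℂ, E) 𝓘(ℂ, E) e.symm (a t) : E →L[ℂ] E) (one_smul ℂ a')

lemma fderiv_chartRep_chartField_const (he : e ∈ IsManifold.maximalAtlas 𝓘(ℂ, E) ω M) {p : M}
    (hp : p ∈ e.source) (u : E) :
    fderiv ℂ (chartRep e (chartField e fun _ => u)) (e p) = 0 := by
  rw [(chartRep_chartField_eventuallyEq he (e.map_source hp) fun _ => u).fderiv_eq]
  simp

/-- Along the curve the expression of `X` is `b = a'`, so the chain rule gives `b'`. In particular
the result does not depend on how the velocity is extended to a field. -/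
lemma fderiv_chartRep_along_curve (he : e ∈ IsManifold.maximalAtlas 𝓘(ℂ, E) ω M) {a b : ℂ → E}
    {b' : E} {t : ℂ} (ht : a t ∈ e.target) (ha : ∀ᶠ s in 𝓝 t, HasDerivAt a (b s) s)
    (hb : HasDerivAt b b' t) {X : VField E M} (hX : DifferentiableAt ℂ (chartRep e X) (a t))
    (hXv : ∀ᶠ s in 𝓝 t, X (e.symm (a s)) = velocity (fun s => e.symm (a s)) s) :
    fderiv ℂ (chartRep e X) (a t) (b t) = b' := by
  have hat := ha.self_of_nhds
  have h1 := hX.hasFDerivAt.comp_hasDerivAt t hat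
  refine h1.unique (hb.congr_of_eventuallyEq ?_)
  filter_upwards [ha, hXv, hat.continuousAt.eventually (e.open_target.mem_nhds ht)] with s hs hv hts
  change dChart e _ (X _) = _
  rw [hv, velocity_chart_symm_comp he hts hs, dChart_dChartSymm he (e.map_target hts)]

variable [IsManifold 𝓘(ℂ, E) ω M] [CompleteSpace E] [FiniteDimensional ℂ E]

/-- The Christoffel symbols of a holomorphic affine connection in a chart. -/
lemma IsHolAffineConnection.exists_christoffel (he : e ∈ IsManifold.maximalAtlas 𝓘(ℂ, E) ω M)
    {cov : ConnOp E M} {U : Set M} (h : IsHolAffineConnection cov U) :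
    ∃ A : E → E →L[ℂ] E →L[ℂ] E, ContDiffOn ℂ ω A (e.target ∩ e.symm ⁻¹' U) ∧
      ∀ p ∈ U ∩ e.source, ∀ X : VField E M,
        MDifferentiableAt 𝓘(ℂ, E) 𝓘(ℂ, E).tangent (T% X) p → ∀ v : TangentSpace 𝓘(ℂ, E) p,
        dChart e p (cov X p v) = fderiv ℂ (chartRep e X) (e p) (dChart e p v) +
          A (e p) (dChart e p (X p)) (dChart e p v) := by
  have h1 := h.isCov.mono (inter_subset_left (t := e.source))
  have h2 := (isCovariantDerivativeOn_chartConn he).mono (inter_subset_right (s := U))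
  -- The difference from the flat connection of the chart is a tensor; its expression in the chart
  -- gives the Christoffel symbols.
  let D := h1.difference h2
  let A₀ : E → E →ₗ[ℂ] E →ₗ[ℂ] E := fun z =>
    LinearMap.mk₂ ℂ (fun u w => dChart e (e.symm z)
      (D (e.symm z) (dChartSymm e (e.symm z) u) (dChartSymm e (e.symm z) w)))
      (by intros; simp) (by intros; simp) (by intros; simp) (by intros; simp)
  let A : E → E →L[ℂ] E →L[ℂ] E := fun z => LinearMap.toContinuousLinearMap
    ((LinearMap.toContinuousLinearMap : (E →ₗ[ℂ] E) ≃ₗ[ℂ] E →L[ℂ] E).toLinearMap ∘ₗ A₀ z)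
  have hA : ∀ p ∈ e.source, ∀ u w, A (e p) u w =
      dChart e p (D p (dChartSymm e p u) (dChartSymm e p w)) := by
    intro p hp u w
    change dChart e (e.symm (e p)) (D (e.symm (e p)) (dChartSymm e (e.symm (e p)) u)
      (dChartSymm e (e.symm (e p)) w)) = _
    rw [e.left_inv hp]
  have key : ∀ p ∈ U ∩ e.source, ∀ X : VField E M,
        MDifferentiableAt 𝓘(ℂ, E) 𝓘(ℂ, E).tangent (T% X) p → ∀ v : TangentSpace 𝓘(ℂ, E) p,
        dChart e p (cov X p v) = fderiv ℂ (chartRep e X) (e p) (dChart e p v) +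
          A (e p) (dChart e p (X p)) (dChart e p v) := by
    intro p hp X hX v
    rw [hA p hp.2, dChartSymm_dChart he hp.2, dChartSymm_dChart he hp.2,
      h1.difference_apply h2 hp hX, sub_apply, map_sub, dChart_chartConn he hp.2]
    abel
  refine ⟨A, ?_, key⟩
  have hopen : IsOpen (e.target ∩ e.symm ⁻¹' U) :=
    e.symm.isOpen_inter_preimage h.isOpen
  rw [contDiffOn_clm_apply]
  intro u
  rw [contDiffOn_clm_apply]
  intro w z hz
  refine ContDiffAt.contDiffWithinAt ?_
  -- On fields that are constant in the chart the flat derivative vanishes, so `A z u w` is the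
  -- expression of the covariant derivative of `Xu` along `Xw`, which is holomorphic.
  let Xu : VField E M := chartField e fun _ => u
  let Xw : VField E M := chartField e fun _ => w
  have hXu : ∀ p ∈ e.source, ContMDiffAt 𝓘(ℂ, E) 𝓘(ℂ, E).tangent ω (T% Xu) p :=
    fun p hp => contMDiffAt_chartField he hp contDiffAt_const
  have hXw : ∀ p ∈ e.source, ContMDiffAt 𝓘(ℂ, E) 𝓘(ℂ, E).tangent ω (T% Xw) p :=
    fun p hp => contMDiffAt_chartField he hp contDiffAt_const
  have hV : IsOpen (U ∩ e.source) := h.isOpen.inter e.open_source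
  have hp : e.symm z ∈ U ∩ e.source := ⟨hz.2, e.map_target hz.1⟩
  have h3 := (h.holo _ hV inter_subset_left).contMDiff (σ := Xu)
    (fun p hp => (hXu p hp.2).contMDiffWithinAt)
  have h4 := (h3.contMDiffAt (hV.mem_nhds hp)).clm_bundle_apply (hXw _ hp.2)
  have h5 := (contMDiffAt_iff_chartRep he hp.2 (Y := fun q => cov Xu q (Xw q))).1 h4
  rw [e.right_inv hz.1] at h5
  refine h5.congr_of_eventuallyEq ?_
  filter_upwards [hopen.mem_nhds hz] with y hy
  have h6 := key (e.symm y) ⟨hy.2, e.map_target hy.1⟩ Xu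
    ((hXu _ (e.map_target hy.1)).mdifferentiableAt (by simp)) (Xw (e.symm y))
  rw [fderiv_chartRep_chartField_const he (e.map_target hy.1), zero_apply, zero_add,
    e.right_inv hy.1] at h6
  change _ = dChart e (e.symm y) (cov Xu (e.symm y) (Xw (e.symm y)))
  rw [h6]
  congr 1
  · congr 1
    exact (chartRep_chartField he hy.1 fun _ => u).symm
  · exact (chartRep_chartField he hy.1 fun _ => w).symm

end Christoffel

/-! ### Non-parametrized geodesics and projective equivalence -/

section Geodesics

open Filter Set Metric

/-- Local existence of the solutions of the equation of the non-parametrized geodesics, which are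
parametrized by the linear coordinate `l`. -/
lemma exists_geodesic_curve {E : Type*} [NormedAddCommGroup E] [NormedSpace ℂ E] [CompleteSpace E]
    {A : E → E →L[ℂ] E →L[ℂ] E} {x₀ u : E} (hA : ContDiffAt ℂ ω A x₀) (l : E →L[ℂ] ℂ)
    (hl : l u = 1) :
    ∃ r > 0, ∃ a b : ℂ → E, a 0 = x₀ ∧ b 0 = u ∧ ∀ t ∈ ball (0 : ℂ) r,
      HasDerivAt a (b t) t ∧
      HasDerivAt b (l (A (a t) (b t) (b t)) • b t - A (a t) (b t) (b t)) t ∧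
      l (b t) = 1 ∧ l (a t) = l x₀ + t := by
  -- A projection onto the hyperplane `l = 1`. Inserting it into the equation makes `l` of the
  -- velocity's derivative vanish identically, so `l b = 1` persists without appeal to uniqueness of
  -- solutions; then `n b = b` and the intended equation holds.
  let n : E → E := fun w => w + (1 - l w) • u
  have hn : ∀ w, l (n w) = 1 := by
    intro w
    simp [n, hl]
  have hn1 : ∀ w, l w = 1 → n w = w := by
    intro w hw
    simp [n, hw]
  have hnd : ContDiff ℂ 1 n :=
    contDiff_id.add ((contDiff_const.sub l.contDiff).smul contDiff_const)
  let F : E × E → E × E := fun y =>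
    (n y.2, l (A y.1 (n y.2) (n y.2)) • n y.2 - A y.1 (n y.2) (n y.2))
  have hF : ContDiffAt ℂ 1 F (x₀, u) := by
    have h1 : ContDiffAt ℂ 1 (fun y : E × E => n y.2) (x₀, u) :=
      hnd.contDiffAt.comp (x₀, u) contDiffAt_snd
    have h2 : ContDiffAt ℂ 1 (fun y : E × E => A y.1) (x₀, u) :=
      ContDiffAt.comp (x₀, u) (hA.of_le (by simp)) contDiffAt_fst
    have h3 : ContDiffAt ℂ 1 (fun y : E × E => A y.1 (n y.2) (n y.2)) (x₀, u) :=
      (h2.clm_apply h1).clm_apply h1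
    exact h1.prodMk (((l.contDiff.contDiffAt.comp (x₀, u) h3).smul h1).sub h3)
  obtain ⟨r, hr, y, hy0, hy⟩ := exists_hasDerivAt_complex_ode hF
  have ha : ∀ t ∈ ball (0 : ℂ) r, HasDerivAt (fun t => (y t).1) (n (y t).2) t := fun t ht =>
    (ContinuousLinearMap.fst ℂ E E).hasFDerivAt.comp_hasDerivAt t (hy t ht)
  have hb : ∀ t ∈ ball (0 : ℂ) r, HasDerivAt (fun t => (y t).2) (F (y t)).2 t := fun t ht =>
    (ContinuousLinearMap.snd ℂ E E).hasFDerivAt.comp_hasDerivAt t (hy t ht)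
  have hconst : ∀ f : ℂ → ℂ, (∀ t ∈ ball (0 : ℂ) r, HasDerivAt f 0 t) →
      ∀ t ∈ ball (0 : ℂ) r, f t = f 0 := by
    intro f hf t ht
    have := (convex_ball (0 : ℂ) r).norm_image_sub_le_of_norm_hasDerivWithin_le (C := 0)
      (fun t ht => (hf t ht).hasDerivWithinAt) (fun t ht => by simp) (mem_ball_self hr) ht
    simpa [sub_eq_zero] using this
  have hlb : ∀ t ∈ ball (0 : ℂ) r, l (y t).2 = 1 := by
    intro t ht
    refine (hconst (fun t => l (y t).2) (fun t ht => ?_) t ht).trans (by simp [hy0, hl])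
    refine (l.hasFDerivAt.comp_hasDerivAt t (hb t ht)).congr_deriv ?_
    simp [F, hn]
  have hla : ∀ t ∈ ball (0 : ℂ) r, l (y t).1 = l x₀ + t := by
    intro t ht
    have := hconst (fun t => l (y t).1 - t) (fun t ht => ?_) t ht
    · simp only [hy0, sub_zero] at this
      rw [← this]
      ring
    · refine ((l.hasFDerivAt.comp_hasDerivAt t (ha t ht)).sub (hasDerivAt_id t)).congr_deriv ?_
      simp [hn]
  refine ⟨r, hr, fun t => (y t).1, fun t => (y t).2, by simp [hy0], by simp [hy0],
    fun t ht => ⟨?_, ?_, hlb t ht, hla t ht⟩⟩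
  · have := ha t ht
    rwa [hn1 _ (hlb t ht)] at this
  · have := hb t ht
    simp only [F, hn1 _ (hlb t ht)] at this
    exact this

variable {E : Type*} [NormedAddCommGroup E] [NormedSpace ℂ E]
  {M : Type*} [TopologicalSpace M] [ChartedSpace E M] {e : OpenPartialHomeomorph M E}
  [IsManifold 𝓘(ℂ, E) ω M]

/-- The same extension of the velocity works for both connections; only the factor of
proportionality changes. -/
lemma IsNonparamGeodesic.of_sub_eq_smul {cov cov' : ConnOp E M} {W : Set M}
    (h : ∀ x ∈ W, ∀ X : VField E M, MDifferentiableAt 𝓘(ℂ, E) 𝓘(ℂ, E).tangent (T% X) x →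
      ∃ c : ℂ, cov X x (X x) - cov' X x (X x) = c • X x) {D : Set ℂ} {γ : ℂ → M}
    (hγ : IsNonparamGeodesic cov W D γ) : IsNonparamGeodesic cov' W D γ where
  isOpen := hγ.isOpen
  mapsTo := hγ.mapsTo
  holo := hγ.holo
  immersed := hγ.immersed
  geodesic t ht := by
    obtain ⟨X, hX, hXv, c, hc⟩ := hγ.geodesic t ht
    obtain ⟨d, hd⟩ := h _ (hγ.mapsTo ht) X (hX.mdifferentiableAt (by simp))
    refine ⟨X, hX, hXv, c - d, ?_⟩
    rw [sub_smul, ← hd, hc]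
    abel

variable [CompleteSpace E]

/-- Every direction is tangent to a non-parametrized geodesic. -/
lemma IsHolAffineConnection.exists_geodesic (he : e ∈ IsManifold.maximalAtlas 𝓘(ℂ, E) ω M)
    {cov : ConnOp E M} {U : Set M} (h : IsHolAffineConnection cov U) {W : Set M} (hW : IsOpen W)
    (hWU : W ⊆ U) {A : E → E →L[ℂ] E →L[ℂ] E} (hA : ContDiffOn ℂ ω A (e.target ∩ e.symm ⁻¹' U))
    (hcov : ∀ p ∈ U ∩ e.source, ∀ X : VField E M,
      MDifferentiableAt 𝓘(ℂ, E) 𝓘(ℂ, E).tangent (T% X) p → ∀ v : TangentSpace 𝓘(ℂ, E) p,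
      dChart e p (cov X p v) = fderiv ℂ (chartRep e X) (e p) (dChart e p v) +
        A (e p) (dChart e p (X p)) (dChart e p v))
    {x : M} (hxW : x ∈ W) (hxe : x ∈ e.source) {u : E} (hu : u ≠ 0) :
    ∃ (a b : ℂ → E) (b' : E) (D : Set ℂ), 0 ∈ D ∧ a 0 = e x ∧ b 0 = u ∧
      (∀ᶠ s in 𝓝 0, HasDerivAt a (b s) s) ∧ HasDerivAt b b' 0 ∧
      (∃ c : ℂ, b' + A (e x) u u = c • u) ∧
      IsNonparamGeodesic cov W D (fun s => e.symm (a s)) := by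
  obtain ⟨l, hl⟩ := SeparatingDual.exists_eq_one (R := ℂ) hu
  have hx : e x ∈ e.target ∩ e.symm ⁻¹' U :=
    ⟨e.map_source hxe, by simpa [e.left_inv hxe] using hWU hxW⟩
  obtain ⟨r, hr, a, b, ha0, hb0, hab⟩ := exists_geodesic_curve
    (hA.contDiffAt ((e.symm.isOpen_inter_preimage h.isOpen).mem_nhds hx)) l hl
  have haan : ∀ t ∈ ball (0 : ℂ) r, ContDiffAt ℂ ω a t := by
    have : DifferentiableOn ℂ a (ball 0 r) := fun t ht =>
      (hab t ht).1.differentiableAt.differentiableWithinAt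
    exact fun t ht => (this.analyticAt (isOpen_ball.mem_nhds ht)).contDiffAt
  have hban : ∀ t ∈ ball (0 : ℂ) r, ContDiffAt ℂ ω b t := by
    have : DifferentiableOn ℂ b (ball 0 r) := fun t ht =>
      (hab t ht).2.1.differentiableAt.differentiableWithinAt
    exact fun t ht => (this.analyticAt (isOpen_ball.mem_nhds ht)).contDiffAt
  -- The times at which the curve remains both in the chart and over `W`.
  let D : Set ℂ := ball 0 r ∩ a ⁻¹' (e.target ∩ e.symm ⁻¹' W)
  have hDopen : IsOpen D :=
    ContinuousOn.isOpen_inter_preimage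
      (fun t ht => (haan t ht).continuousAt.continuousWithinAt) isOpen_ball
      (e.symm.isOpen_inter_preimage hW)
  have h0D : (0 : ℂ) ∈ D := by
    refine ⟨mem_ball_self hr, ?_⟩
    change a 0 ∈ e.target ∩ e.symm ⁻¹' W
    rw [ha0]
    exact ⟨hx.1, by simpa [e.left_inv hxe] using hxW⟩
  have h0 := hab 0 (mem_ball_self hr)
  refine ⟨a, b, l (A (a 0) (b 0) (b 0)) • b 0 - A (a 0) (b 0) (b 0), D, h0D, ha0, hb0, ?_, h0.2.1,
    ⟨l (A (e x) u u), ?_⟩, ?_⟩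
  · filter_upwards [isOpen_ball.mem_nhds (mem_ball_self hr)] with s hs using (hab s hs).1
  · rw [ha0, hb0, sub_add_cancel]
  have hvel : ∀ t ∈ D, velocity (E := E) (fun s => e.symm (a s)) t =
      dChartSymm e (e.symm (a t)) (b t) := fun t ht =>
    velocity_chart_symm_comp he ht.2.1 (hab t ht.1).1
  have hlt : ∀ t ∈ D, l (a t) - l (e x) = t := fun t ht => by
    rw [(hab t ht.1).2.2.2]; ring
  refine ⟨hDopen, fun t ht => ht.2.2, fun t ht => ?_, fun t ht => ?_, fun t ht => ?_⟩
  · exact ((contMDiffAt_symm_of_mem_maximalAtlas he ht.2.1).comp t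
      (haan t ht.1).contMDiffAt).contMDiffWithinAt
  · rw [hvel t ht]
    intro h0
    have h1 := congrArg (dChart e (e.symm (a t))) h0
    rw [dChart_dChartSymm he (e.map_target ht.2.1), map_zero] at h1
    have h2 := (hab t ht.1).2.2.1
    rw [h1, map_zero] at h2
    exact zero_ne_one h2
  · have hp : e.symm (a t) ∈ U ∩ e.source := ⟨hWU ht.2.2, e.map_target ht.2.1⟩
    -- Since `l (a t) - l (e x) = t`, time is a function of position on the curve; substituting it
    -- into `b` extends the velocity to a holomorphic field.
    let X : VField E M := chartField e fun z => b (l z - l (e x))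
    have hXd : ContMDiffAt 𝓘(ℂ, E) 𝓘(ℂ, E).tangent ω (T% X) (e.symm (a t)) := by
      refine contMDiffAt_chartField he hp.2 ?_
      rw [e.right_inv ht.2.1]
      have hbt : ContDiffAt ℂ ω b (l (a t) - l (e x)) := by
        rw [hlt t ht]; exact hban t ht.1
      exact hbt.comp (a t) (f := fun z => l z - l (e x))
        (l.contDiff.contDiffAt.sub contDiffAt_const)
    have hXa : ∀ s ∈ D, X (e.symm (a s)) = dChartSymm e (e.symm (a s)) (b s) := by
      intro s hs
      change dChartSymm e _ (b (l (e (e.symm (a s))) - l (e x))) = _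
      rw [e.right_inv hs.2.1, hlt s hs]
    have hXv : ∀ᶠ s in 𝓝 t, X (e.symm (a s)) = velocity (fun s => e.symm (a s)) s := by
      filter_upwards [hDopen.mem_nhds ht] with s hs
      rw [hXa s hs, hvel s hs]
    refine ⟨X, hXd, hXv, l (A (a t) (b t) (b t)), ?_⟩
    apply dChart_injective he hp.2
    have hrep := (contMDiffAt_iff_chartRep he hp.2).1 hXd
    rw [e.right_inv ht.2.1] at hrep
    rw [hcov _ hp X (hXd.mdifferentiableAt (by simp)), map_smul, hXa t ht,
      dChart_dChartSymm he hp.2, e.right_inv ht.2.1,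
      fderiv_chartRep_along_curve he ht.2.1 ?_ (hab t ht.1).2.1 (hrep.differentiableAt (by simp))
        hXv, sub_add_cancel]
    filter_upwards [isOpen_ball.mem_nhds ht.1] with s hs using (hab s hs).1

/-- Two connections are projectively equivalent if and only if `∇_X X - ∇'_X X` is everywhere
proportional to `X`. -/
lemma projEquivOn_iff [FiniteDimensional ℂ E] {cov cov' : ConnOp E M} {U U' W : Set M} (h : IsHolAffineConnection cov U)
    (h' : IsHolAffineConnection cov' U') (hW : IsOpen W) (hWU : W ⊆ U) (hWU' : W ⊆ U') :
    ProjEquivOn cov cov' W ↔ ∀ x ∈ W, ∀ X : VField E M,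
      MDifferentiableAt 𝓘(ℂ, E) 𝓘(ℂ, E).tangent (T% X) x →
        ∃ c : ℂ, cov X x (X x) - cov' X x (X x) = c • X x := by
  refine ⟨fun hproj x hx X hX => ?_, fun hc D γ => ⟨fun hγ => hγ.of_sub_eq_smul hc,
    fun hγ => hγ.of_sub_eq_smul fun x hx X hX => ?_⟩⟩
  · by_cases hX0 : X x = 0
    · exact ⟨0, by simp [hX0]⟩
    let e := chartAt E x
    have he : e ∈ IsManifold.maximalAtlas 𝓘(ℂ, E) ω M := IsManifold.chart_mem_maximalAtlas x
    have hxe : x ∈ e.source := mem_chart_source E x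
    obtain ⟨A, hA, hcov⟩ := h.exists_christoffel he
    obtain ⟨A', hA', hcov'⟩ := h'.exists_christoffel he
    set u := dChart e x (X x) with hu
    have hu0 : u ≠ 0 := fun h0 => hX0 (dChart_injective he hxe (by rw [← hu, h0, map_zero]))
    obtain ⟨a, b, b', D, h0D, ha0, hb0, ha, hb, ⟨c, hc⟩, hγ⟩ :=
      h.exists_geodesic he hW hWU hA hcov hx hxe hu0
    have ht : a 0 ∈ e.target := ha0 ▸ e.map_source hxe
    -- One curve with initial velocity `u` is a geodesic of both connections, so `b' + A u u` and
    -- `b' + A' u u` are both multiples of `u`. Subtracting eliminates `b'`.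
    have hγ' := (hproj D _).1 hγ
    obtain ⟨X', hX', hXv, c', hc'⟩ := hγ'.geodesic 0 h0D
    have hp : e.symm (a 0) ∈ U' ∩ e.source := ⟨hWU' (hγ'.mapsTo h0D), e.map_target ht⟩
    have hrep := (contMDiffAt_iff_chartRep he hp.2).1 hX'
    rw [e.right_inv ht] at hrep
    have hXu : dChart e (e.symm (a 0)) (X' (e.symm (a 0))) = u := by
      rw [hXv.self_of_nhds, velocity_chart_symm_comp he ht ha.self_of_nhds,
        dChart_dChartSymm he hp.2, hb0]
    have h2 := congrArg (dChart e (e.symm (a 0))) hc'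
    have h3 := fderiv_chartRep_along_curve he ht ha hb (hrep.differentiableAt (by simp)) hXv
    rw [hcov' _ hp X' (hX'.mdifferentiableAt (by simp)), map_smul, hXu, e.right_inv ht, ← hb0, h3,
      hb0, ha0] at h2
    refine ⟨c - c', dChart_injective he hxe ?_⟩
    rw [map_sub, hcov x ⟨hWU hx, hxe⟩ X hX, hcov' x ⟨hWU' hx, hxe⟩ X hX, map_smul, ← hu,
      sub_smul, ← hc, ← h2]
    abel
  · obtain ⟨c, hc⟩ := hc x hx X hX
    exact ⟨-c, by rw [neg_smul, ← hc, neg_sub]⟩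

end Geodesics

/-! ### The standard projective connection -/

namespace CP

open Filter Set

variable {n : ℕ}

/-- The representative with `i`-th homogeneous coordinate `1` of a point with given affine
coordinates. -/
noncomputable def homog (i : Fin (n + 1)) (z : Fin n → ℂ) : Fin (n + 1) → ℂ := i.insertNth 1 z

/-- The vector of `ℂ^(n+1)` with `i`-th coordinate `0` and given other coordinates. -/
noncomputable def homogDir (i : Fin (n + 1)) (v : Fin n → ℂ) : Fin (n + 1) → ℂ := i.insertNth 0 v

/-- The expression in the `j`-th affine chart of the direction of a line, which is given in the
`i`-th affine chart by a point `z` and a direction `v`. -/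
noncomputable def lineDir (i j : Fin (n + 1)) (z v : Fin n → ℂ) : Fin n → ℂ := fun k =>
  homogDir i v (j.succAbove k) * homog i z j - homog i z (j.succAbove k) * homogDir i v j

@[simp] lemma homog_same (i : Fin (n + 1)) (z : Fin n → ℂ) : homog i z i = 1 := by simp [homog]

lemma homog_add_smul (i : Fin (n + 1)) (z v : Fin n → ℂ) (t : ℂ) (l : Fin (n + 1)) :
    homog i (z + t • v) l = homog i z l + t * homogDir i v l := by
  refine Fin.succAboveCases i ?_ (fun k => ?_) l <;> simp [homog, homogDir]

/-- The entries are 2×2 minors of the pair (homogeneous point, homogeneous direction), that is,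
Plücker coordinates of the line; moving the point along the line does not change them. -/
lemma lineDir_add_smul (i j : Fin (n + 1)) (z v : Fin n → ℂ) (t : ℂ) :
    lineDir i j (z + t • v) v = lineDir i j z v := by
  ext k
  simp only [lineDir, homog_add_smul]
  ring

lemma affineChart_mem_maximalAtlas (i : Fin (n + 1)) :
    affineChart i ∈ IsManifold.maximalAtlas 𝓘(ℂ, Fin n → ℂ) ω (CP n) :=
  IsManifold.subset_maximalAtlas (mem_range_self i)

lemma affineChart_symm_mem_source (i j : Fin (n + 1)) (z : Fin n → ℂ) :
    (affineChart i).symm z ∈ (affineChart j).source ↔ homog i z j ≠ 0 :=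
  mk_mem_affineDomain j _ _

lemma mem_affineChart_source_iff {i : Fin (n + 1)} (j : Fin (n + 1)) {p : CP n}
    (hp : p ∈ (affineChart i).source) :
    p ∈ (affineChart j).source ↔ homog i (affineChart i p) j ≠ 0 := by
  rw [← affineChart_symm_mem_source, (affineChart i).left_inv hp]

lemma affineChart_symm_apply (i j : Fin (n + 1)) (z : Fin n → ℂ) (k : Fin n) :
    affineChart j ((affineChart i).symm z) k = homog i z (j.succAbove k) / homog i z j := rfl

lemma homog_affineChart_symm (i j : Fin (n + 1)) (z : Fin n → ℂ) (h : homog i z j ≠ 0) :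
    homog j (affineChart j ((affineChart i).symm z)) i = (homog i z j)⁻¹ := by
  have key : ∀ l, homog j (affineChart j ((affineChart i).symm z)) l
      = homog i z l / homog i z j := by
    intro l
    refine Fin.succAboveCases j ?_ (fun k => ?_) l
    · rw [homog_same, div_self h]
    · rw [← affineChart_symm_apply]
      simp [homog]
  rw [key, homog_same, one_div]

/-- The numerator in the quotient rule is a minor that is constant along the line. So the image
velocity keeps its direction: changes of affine chart map lines to lines. -/
lemma hasDerivAt_affineChart_line (i j : Fin (n + 1)) (z v : Fin n → ℂ) (t : ℂ)
    (h : homog i (z + t • v) j ≠ 0) :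
    HasDerivAt (fun s : ℂ => affineChart j ((affineChart i).symm (z + s • v)))
      ((homog i (z + t • v) j ^ 2)⁻¹ • lineDir i j z v) t := by
  rw [hasDerivAt_pi]
  intro k
  simp only [affineChart_symm_apply, homog_add_smul] at h ⊢
  have h1 : ∀ l, HasDerivAt (fun s : ℂ => homog i z l + s * homogDir i v l) (homogDir i v l) t :=
    fun l => by simpa using ((hasDerivAt_id t).mul_const (homogDir i v l)).const_add (homog i z l)
  refine ((h1 (j.succAbove k)).div (h1 j) h).congr_deriv ?_
  simp only [lineDir, Pi.smul_apply, smul_eq_mul]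
  field_simp
  ring

lemma dChart_dChartSymm_affineChart {i j : Fin (n + 1)} {p : CP n}
    (hi : p ∈ (affineChart i).source) (hj : p ∈ (affineChart j).source) (v : Fin n → ℂ) :
    dChart (affineChart j) p (dChartSymm (affineChart i) p v) =
      (homog i (affineChart i p) j ^ 2)⁻¹ • lineDir i j (affineChart i p) v := by
  have h1 := hasFDerivAt_comp_chart_symm (affineChart_mem_maximalAtlas i) hi
    ((mdifferentiable_of_mem_maximalAtlas (affineChart_mem_maximalAtlas j)).mdifferentiableAt hj)
  have h0 : affineChart i p + (0 : ℂ) • v = affineChart i p := by simp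
  have h2 : HasDerivAt (fun s : ℂ => affineChart i p + s • v) v 0 := by
    simpa using ((hasDerivAt_id (0 : ℂ)).smul_const v).const_add (affineChart i p)
  have h3 := (h0 ▸ h1 : HasFDerivAt _ _ (affineChart i p + (0 : ℂ) • v)).comp_hasDerivAt 0 h2
  have h4 := hasDerivAt_affineChart_line i j (affineChart i p) v 0
    (by rw [h0]; exact (mem_affineChart_source_iff j hi).1 hj)
  rw [h0] at h4
  exact h3.unique h4

/-- The standard connections of the affine charts are projectively equivalent. -/
lemma chartConn_affineChart_sub (i j : Fin (n + 1)) {p : CP n}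
    (hi : p ∈ (affineChart i).source) (hj : p ∈ (affineChart j).source)
    {X : VField (Fin n → ℂ) (CP n)}
    (hX : MDifferentiableAt 𝓘(ℂ, Fin n → ℂ) 𝓘(ℂ, Fin n → ℂ).tangent (T% X) p) :
    ∃ c : ℂ, chartConn (affineChart i) X p (X p) - chartConn (affineChart j) X p (X p) =
      c • X p := by
  have hei := affineChart_mem_maximalAtlas (n := n) i
  have hej := affineChart_mem_maximalAtlas (n := n) j
  obtain ⟨A, -, hA⟩ := (isHolAffineConnection_chartConn hej).exists_christoffel hei
  set u := dChart (affineChart i) p (X p) with hu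
  set z := affineChart i p with hz
  -- The difference of the two connections is tensorial, so `X` may be replaced by the field that is
  -- constant in chart `i` and has the same value at `p`.
  let X₀ : VField (Fin n → ℂ) (CP n) := chartField (affineChart i) fun _ => u
  have hX₀ : MDifferentiableAt 𝓘(ℂ, Fin n → ℂ) 𝓘(ℂ, Fin n → ℂ).tangent (T% X₀) p :=
    (contMDiffAt_chartField hei hi contDiffAt_const).mdifferentiableAt (by simp)
  have hX₀p : dChart (affineChart i) p (X₀ p) = u := dChart_dChartSymm hei hi u
  have hzj : homog i z j ≠ 0 := (mem_affineChart_source_iff j hi).1 hj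
  have hA₀ := hA p ⟨hj, hi⟩ X₀ hX₀ (X₀ p)
  rw [fderiv_chartRep_chartField_const hei hi, zero_apply, zero_add, hX₀p] at hA₀
  have hz0 : z + (0 : ℂ) • u = z := by simp
  have hpz : (affineChart i).symm z = p := (affineChart i).left_inv hi
  have ha := hasDerivAt_affineChart_line i j z u 0 (by rwa [hz0])
  -- In chart `j` the field `X₀` along the line is a scalar function times a fixed vector, so its
  -- derivative is a multiple of itself.
  have hb : HasDerivAt (fun s : ℂ => (homog i (z + s • u) j ^ 2)⁻¹ • lineDir i j z u)
      ((-2 * homogDir i u j / homog i z j) • ((homog i z j ^ 2)⁻¹ • lineDir i j z u)) 0 := by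
    rw [smul_smul]
    refine HasDerivAt.smul_const ?_ _
    simp only [homog_add_smul]
    have h1 : HasDerivAt (fun s : ℂ => homog i z j + s * homogDir i u j) (homogDir i u j) 0 := by
      simpa using ((hasDerivAt_id (0 : ℂ)).mul_const (homogDir i u j)).const_add (homog i z j)
    refine ((h1.pow 2).inv (by simpa using hzj)).congr_deriv ?_
    simp
    field_simp
  have hev : ∀ᶠ s : ℂ in 𝓝 0, homog i (z + s • u) j ≠ 0 := by
    simp only [homog_add_smul]
    refine ContinuousAt.eventually_ne (by fun_prop) (by simpa using hzj)
  have hrep : chartRep (affineChart j) X₀ ∘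
      (fun s : ℂ => affineChart j ((affineChart i).symm (z + s • u))) =ᶠ[𝓝 0]
      fun s : ℂ => (homog i (z + s • u) j ^ 2)⁻¹ • lineDir i j z u := by
    filter_upwards [hev] with s hs
    have hsi : (affineChart i).symm (z + s • u) ∈ (affineChart i).source :=
      (affineChart i).map_target (mem_univ _)
    have hsj := (affineChart_symm_mem_source i j _).2 hs
    rw [Function.comp_apply, chartRep_apply hsj]
    refine (dChart_dChartSymm_affineChart hsi hsj u).trans ?_
    rw [(affineChart i).right_inv (mem_univ _), lineDir_add_smul]
  have hd := (mdifferentiableAt_iff_chartRep hej hj).1 hX₀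
  rw [← hpz, ← hz0] at hd
  have hder := (hd.hasFDerivAt.comp_hasDerivAt (0 : ℂ) ha).unique (hb.congr_of_eventuallyEq hrep)
  rw [hz0, hpz] at hder
  have hX₀j : dChart (affineChart j) p (X₀ p) = (homog i z j ^ 2)⁻¹ • lineDir i j z u :=
    dChart_dChartSymm_affineChart hi hj u
  have hcj : chartConn (affineChart j) X₀ p (X₀ p) =
      (-2 * homogDir i u j / homog i z j) • X₀ p := by
    apply dChart_injective hej hj
    rw [dChart_chartConn hej hj, map_smul, hX₀j, hder]
  rw [hcj, map_smul, hX₀p] at hA₀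
  refine ⟨-(-2 * homogDir i u j / homog i z j), dChart_injective hei hi ?_⟩
  rw [map_sub, hA p ⟨hj, hi⟩ X hX, dChart_chartConn hei hi, map_smul, ← hu, ← hz, ← hA₀, neg_smul,
    sub_add_cancel_left]

lemma isProjConnection_standard : IsProjConnection (standardProjConnection n) where
  cover := by
    refine eq_univ_of_forall fun p => ?_
    obtain ⟨i, hi⟩ := exists_mem_affineDomain p
    exact mem_iUnion₂.2 ⟨_, mem_range_self i, hi⟩
  connection := by
    rintro _ ⟨i, rfl⟩
    exact isHolAffineConnection_chartConn (affineChart_mem_maximalAtlas i)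
  torsionFree := by
    rintro _ ⟨i, rfl⟩
    exact isTorsionFreeOn_chartConn (affineChart_mem_maximalAtlas i)
  compatible := by
    rintro _ ⟨i, rfl⟩ _ ⟨j, rfl⟩
    refine (projEquivOn_iff (isHolAffineConnection_chartConn (affineChart_mem_maximalAtlas i))
      (isHolAffineConnection_chartConn (affineChart_mem_maximalAtlas j))
      ((affineChart i).open_source.inter (affineChart j).open_source)
      inter_subset_left inter_subset_right).2 fun p hp X hX => ?_
    exact chartConn_affineChart_sub i j hp.1 hp.2 hX

lemma isFlatProjConnection_standard : IsFlatProjConnection (standardProjConnection n) := by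
  refine ⟨_, isProjConnection_standard, ?_, ?_⟩
  · rintro _ ⟨i, rfl⟩
    exact isFlatOn_chartConn (affineChart_mem_maximalAtlas i)
  · rw [ProjConnectionEquiv, union_self]
    exact isProjConnection_standard

end CP

/-! ### Uniqueness of the projective connection -/

namespace CP

open Filter Set

variable {n : ℕ} {S : Set (LocalConn (Fin n → ℂ) (CP n))}

lemma tendsto_affine_inv_cocompact {a b : ℂ} (hb : b ≠ 0) :
    Tendsto (fun t : ℂ => (a + t * b)⁻¹) (cocompact ℂ) (𝓝 0) := by
  have h : Tendsto (fun t : ℂ => a + t * b) (cocompact ℂ) (cocompact ℂ) :=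
    ((Homeomorph.mulRight₀ b hb).trans (Homeomorph.addLeft a)).isClosedEmbedding.tendsto_cocompact
  rw [← Metric.cobounded_eq_cocompact] at h ⊢
  exact tendsto_inv₀_cobounded.comp h

lemma div_add_mul_inv_affine {a b c d t : ℂ} (hd : d ≠ 0) (h : b + t * d ≠ 0) :
    c / d + (a - b * c / d) * (b + t * d)⁻¹ = (a + t * c) / (b + t * d) := by
  rw [eq_div_iff h, add_mul, mul_assoc, inv_mul_cancel₀ h]
  field_simp
  ring

lemma differentiableAt_comp_line {E : Type*} [NormedAddCommGroup E] [NormedSpace ℂ E]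
    {A : E → E →L[ℂ] E →L[ℂ] E} (l : E →L[ℂ] ℂ) (z v : E) {t : ℂ}
    (hA : ContDiffAt ℂ ω A (z + t • v)) :
    DifferentiableAt ℂ (fun s : ℂ => l (A (z + s • v) v v)) t := by
  have h0 : ContDiffAt ℂ ω (fun s : ℂ => z + s • v) t := by fun_prop
  have h1 : ContDiffAt ℂ ω (fun s : ℂ => A (z + s • v)) t := ContDiffAt.comp t hA h0
  have h2 : ContDiffAt ℂ ω (fun s : ℂ => A (z + s • v) v v) t :=
    (h1.clm_apply contDiffAt_const).clm_apply contDiffAt_const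
  exact l.differentiableAt.comp t (h2.differentiableAt (by simp))

/-- Members of a projective connection induce the same symmetric tensor with values in the
quotients of the tangent spaces by lines. -/
lemma exists_sub_eq_smul (hS : IsProjConnection S) {L L' : LocalConn (Fin n → ℂ) (CP n)}
    (hL : L ∈ S) (hL' : L' ∈ S) {p : CP n} (hp : p ∈ L.dom) (hp' : p ∈ L'.dom)
    {X : VField (Fin n → ℂ) (CP n)}
    (hX : MDifferentiableAt 𝓘(ℂ, Fin n → ℂ) 𝓘(ℂ, Fin n → ℂ).tangent (T% X) p) :
    ∃ c : ℂ, L.cov X p (X p) - L'.cov X p (X p) = c • X p :=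
  (projEquivOn_iff (hS.connection L hL) (hS.connection L' hL')
    ((hS.connection L hL).isOpen.inter (hS.connection L' hL').isOpen)
    inter_subset_left inter_subset_right).1 (hS.compatible L hL L' hL') p ⟨hp, hp'⟩ X hX

lemma exists_mem_dom (hS : IsProjConnection S) (p : CP n) : ∃ L ∈ S, p ∈ L.dom := by
  have := hS.cover ▸ mem_univ p
  simpa using this

/-- The value at infinity of the second fundamental form of a line vanishes. -/
lemma tendsto_secondForm (hS : IsProjConnection S) (i : Fin (n + 1)) (z : Fin n → ℂ)
    {v : Fin n → ℂ} (hv : v ≠ 0) (l : (Fin n → ℂ) →L[ℂ] ℂ) (hl : l v = 0) (f : ℂ → ℂ)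
    (hf : ∀ t, ∀ L ∈ S, (affineChart i).symm (z + t • v) ∈ L.dom →
      f t = l (dChart (affineChart i) ((affineChart i).symm (z + t • v))
        (L.cov (chartField (affineChart i) fun _ => v) ((affineChart i).symm (z + t • v))
          (chartField (affineChart i) (fun _ => v) ((affineChart i).symm (z + t • v)))))) :
    Tendsto f (cocompact ℂ) (𝓝 0) := by
  -- A nonzero coordinate of `v` selects a chart `j` containing the point at infinity of the line;
  -- its coordinates there are `z'` below.
  obtain ⟨k₀, hk₀⟩ := Function.ne_iff.1 hv
  set j := i.succAbove k₀ with hj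
  have hei := affineChart_mem_maximalAtlas (n := n) i
  have hej := affineChart_mem_maximalAtlas (n := n) j
  have hVj : homogDir i v j ≠ 0 := by simpa [hj, homogDir] using hk₀
  set X₀ : VField (Fin n → ℂ) (CP n) := chartField (affineChart i) fun _ => v with hX₀def
  set B := lineDir i j z v
  let q : ℂ → CP n := fun t => (affineChart i).symm (z + t • v)
  have hqi : ∀ t, q t ∈ (affineChart i).source := fun t => (affineChart i).map_target (mem_univ _)
  have hiq : ∀ t, affineChart i (q t) = z + t • v := fun t =>
    (affineChart i).right_inv (mem_univ _)
  let H : ℂ → ℂ := fun t => homog i (z + t • v) j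
  have hH : Tendsto (fun t => (H t)⁻¹) (cocompact ℂ) (𝓝 0) := by
    simp only [H, homog_add_smul]
    exact tendsto_affine_inv_cocompact hVj
  let z' : Fin n → ℂ := fun k => homogDir i v (j.succAbove k) / homogDir i v j
  have hH0 : ∀ᶠ t in cocompact ℂ, H t ≠ 0 := by
    have : {-homog i z j / homogDir i v j}ᶜ ∈ cocompact ℂ :=
      isCompact_singleton.compl_mem_cocompact
    filter_upwards [this] with t ht h0
    apply ht
    simp only [H, homog_add_smul] at h0
    rw [mem_singleton_iff, eq_div_iff hVj]
    linear_combination h0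
  have hlim : Tendsto (fun t => affineChart j (q t)) (cocompact ℂ) (𝓝 z') := by
    rw [tendsto_pi_nhds]
    intro k
    have h1 := (hH.const_mul (homog i z (j.succAbove k) -
      homog i z j * homogDir i v (j.succAbove k) / homogDir i v j)).const_add (z' k)
    rw [mul_zero, add_zero] at h1
    refine h1.congr' ?_
    filter_upwards [hH0] with t ht
    simp only [q, affineChart_symm_apply, z']
    simp only [H, homog_add_smul] at ht ⊢
    exact div_add_mul_inv_affine hVj ht
  obtain ⟨L, hL, hzL⟩ := exists_mem_dom hS ((affineChart j).symm z')
  have hLc := hS.connection L hL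
  obtain ⟨A, hAd, hA⟩ := hLc.exists_christoffel hej
  have hopen := (affineChart j).symm.isOpen_inter_preimage hLc.isOpen
  have hmem : z' ∈ (affineChart j).target ∩ (affineChart j).symm ⁻¹' L.dom := ⟨mem_univ _, hzL⟩
  have hAz : ContinuousAt A z' := (hAd.contDiffAt (hopen.mem_nhds hmem)).continuousAt
  have hdom : ∀ᶠ t in cocompact ℂ, affineChart j (q t) ∈
      (affineChart j).target ∩ (affineChart j).symm ⁻¹' L.dom :=
    hlim.eventually (hopen.mem_nhds hmem)
  have hw : Tendsto (fun t => A (affineChart j (q t)) B B) (cocompact ℂ) (𝓝 (A z' B B)) :=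
    ((hAz.clm_apply continuousAt_const).clm_apply continuousAt_const).tendsto.comp hlim
  have hcont : Continuous fun y : (Fin n → ℂ) × (Fin n → ℂ) => l (lineDir j i y.1 y.2) := by
    have hins : ∀ (c : ℂ) (m : Fin (n + 1)),
        Continuous fun y : Fin n → ℂ => (j.insertNth c y : Fin (n + 1) → ℂ) m := by
      intro c m
      refine Fin.succAboveCases j ?_ (fun k => ?_) m
      · simpa using continuous_const
      · simpa using continuous_apply k
    refine l.continuous.comp (continuous_pi fun k => ?_)
    exact (((hins 0 _).comp continuous_snd).mul ((hins 1 _).comp continuous_fst)).sub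
      (((hins 1 _).comp continuous_fst).mul ((hins 0 _).comp continuous_snd))
  have hfin := ((hH.pow 2).mul
    ((hcont.tendsto (z', A z' B B)).comp (hlim.prodMk_nhds hw)))
  rw [zero_pow two_ne_zero, zero_mul] at hfin
  refine hfin.congr' ?_
  filter_upwards [hH0, hdom] with t ht htL
  have hqj : q t ∈ (affineChart j).source := (affineChart_symm_mem_source i j _).2 ht
  have hqL : q t ∈ L.dom := by
    have := htL.2
    rwa [mem_preimage, (affineChart j).left_inv hqj] at this
  have hX₀ : MDifferentiableAt 𝓘(ℂ, Fin n → ℂ) 𝓘(ℂ, Fin n → ℂ).tangent (T% X₀) (q t) :=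
    (contMDiffAt_chartField hei (hqi t) contDiffAt_const).mdifferentiableAt (by simp)
  obtain ⟨c, hc⟩ := chartConn_affineChart_sub i j (hqi t) hqj hX₀
  have hci : chartConn (affineChart i) X₀ (q t) (X₀ (q t)) = 0 := by
    apply dChart_injective hei (hqi t)
    rw [dChart_chartConn hei (hqi t), fderiv_chartRep_chartField_const hei (hqi t), map_zero,
      zero_apply]
  have hXj : dChart (affineChart j) (q t) (X₀ (q t)) = (H t ^ 2)⁻¹ • B := by
    refine (dChart_dChartSymm_affineChart (hqi t) hqj v).trans ?_
    rw [hiq, lineDir_add_smul]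
  have hXi : dChart (affineChart i) (q t) (X₀ (q t)) = v := dChart_dChartSymm hei (hqi t) v
  -- `X₀` is parallel for chart `i`, so its derivative for chart `j` is a multiple of `X₀`. What
  -- remains is the Christoffel term, quadratic in `H⁻² B`, hence of order `H⁻⁴`.
  have hcovL : L.cov X₀ (q t) (X₀ (q t)) = (-c) • X₀ (q t) + dChartSymm (affineChart j) (q t)
      (((H t ^ 2)⁻¹ * (H t ^ 2)⁻¹) • A (affineChart j (q t)) B B) := by
    apply dChart_injective hej hqj
    rw [hci, zero_sub] at hc
    rw [hA _ ⟨hqL, hqj⟩ X₀ hX₀, map_add, dChart_dChartSymm hej hqj, hXj, ← hXj,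
      ← dChart_chartConn hej hqj, neg_smul, ← hc, neg_neg, hXj]
    simp [smul_smul]
  -- `l` kills the multiple of `v`. Returning to chart `i` contributes a factor `H²`, so `f` is
  -- `H⁻²` times a convergent quantity.
  rw [hf t L hL hqL, hcovL, map_add, map_smul, hXi, map_smul, map_smul,
    dChart_dChartSymm_affineChart hqj (hqi t), homog_affineChart_symm i j _ ht]
  simp only [map_add, map_smul, hl, mul_zero, zero_add, smul_eq_mul, Function.comp_apply]
  simp only [H] at ht ⊢
  field_simp

/-- Lines are geodesics of every holomorphic projective connection. -/
lemma secondForm_eq_zero (hS : IsProjConnection S) {L : LocalConn (Fin n → ℂ) (CP n)} (hL : L ∈ S)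
    (i : Fin (n + 1)) {p : CP n} (hpL : p ∈ L.dom) (hpi : p ∈ (affineChart i).source)
    {v : Fin n → ℂ} (hv : v ≠ 0) (l : (Fin n → ℂ) →L[ℂ] ℂ) (hl : l v = 0) :
    l (dChart (affineChart i) p (L.cov (chartField (affineChart i) fun _ => v) p
      (chartField (affineChart i) (fun _ => v) p))) = 0 := by
  have hei := affineChart_mem_maximalAtlas (n := n) i
  set X₀ : VField (Fin n → ℂ) (CP n) := chartField (affineChart i) fun _ => v with hX₀def
  set z := affineChart i p with hz
  let q : ℂ → CP n := fun t => (affineChart i).symm (z + t • v)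
  have hqi : ∀ t, q t ∈ (affineChart i).source := fun t => (affineChart i).map_target (mem_univ _)
  have hiq : ∀ t, affineChart i (q t) = z + t • v := fun t =>
    (affineChart i).right_inv (mem_univ _)
  have hq0 : q 0 = p := by
    simp only [q, zero_smul, add_zero]
    exact (affineChart i).left_inv hpi
  have hX₀ : ∀ t, MDifferentiableAt 𝓘(ℂ, Fin n → ℂ) 𝓘(ℂ, Fin n → ℂ).tangent (T% X₀) (q t) :=
    fun t => (contMDiffAt_chartField hei (hqi t) contDiffAt_const).mdifferentiableAt (by simp)
  have hXi : ∀ t, dChart (affineChart i) (q t) (X₀ (q t)) = v :=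
    fun t => dChart_dChartSymm hei (hqi t) v
  choose Λ hΛ hΛq using fun t => exists_mem_dom hS (q t)
  -- The choice of member at each time is immaterial: two members differ by a multiple of `X₀`,
  -- which `l` annihilates. Using one member near each time shows that `f` is entire.
  let f : ℂ → ℂ := fun t => l (dChart (affineChart i) (q t) ((Λ t).cov X₀ (q t) (X₀ (q t))))
  have hf : ∀ t, ∀ L ∈ S, q t ∈ L.dom →
      f t = l (dChart (affineChart i) (q t) (L.cov X₀ (q t) (X₀ (q t)))) := by
    intro t L hL hqL
    obtain ⟨c, hc⟩ := exists_sub_eq_smul hS (hΛ t) hL (hΛq t) hqL (hX₀ t)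
    rw [sub_eq_iff_eq_add] at hc
    simp only [f]
    rw [hc, map_add, map_smul, hXi, map_add, map_smul, hl, smul_zero, zero_add]
  have hdiff : Differentiable ℂ f := by
    intro t
    obtain ⟨A, hAd, hA⟩ := (hS.connection _ (hΛ t)).exists_christoffel hei
    have hopen := (affineChart i).symm.isOpen_inter_preimage (hS.connection _ (hΛ t)).isOpen
    have hmem : z + t • v ∈ (affineChart i).target ∩ (affineChart i).symm ⁻¹' (Λ t).dom :=
      ⟨mem_univ _, hΛq t⟩
    have hline : ContinuousAt (fun s : ℂ => z + s • v) t := by fun_prop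
    refine (differentiableAt_comp_line l z v (hAd.contDiffAt (hopen.mem_nhds hmem))).congr_of_eventuallyEq ?_
    filter_upwards [hline.eventually (hopen.mem_nhds hmem)] with s hs
    rw [hf s _ (hΛ t) hs.2, hA _ ⟨hs.2, hqi s⟩ X₀ (hX₀ s), hXi, hiq, ← hiq,
      fderiv_chartRep_chartField_const hei (hqi s), zero_apply, zero_add, hiq]
  -- Liouville's theorem.
  have h0 := hdiff.apply_eq_of_tendsto_cocompact 0 (tendsto_secondForm hS i z hv l hl f hf)
  rwa [hf 0 L hL (hq0 ▸ hpL), hq0] at h0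

lemma exists_eq_smul_of_forall_dual {E : Type*} [NormedAddCommGroup E] [NormedSpace ℂ E]
    [FiniteDimensional ℂ E] {v w : E} (h : ∀ l : E →L[ℂ] ℂ, l v = 0 → l w = 0) :
    ∃ c : ℂ, w = c • v := by
  by_contra hc
  have hw : w ∉ Submodule.span ℂ {v} := fun hw => by
    obtain ⟨c, hc'⟩ := Submodule.mem_span_singleton.1 hw
    exact hc ⟨c, hc'.symm⟩
  obtain ⟨l, hlw, hl⟩ := Submodule.exists_le_ker_of_notMem hw
  refine hlw (h (LinearMap.toContinuousLinearMap l) ?_)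
  exact hl (Submodule.mem_span_singleton_self v)

/-- The difference depends only on the value `v` of `X` at `p`, so it can be computed on a constant
field. By `secondForm_eq_zero` every functional killing `v` kills it, hence it is a multiple of `v`.
-/
lemma cov_sub_chartConn (hS : IsProjConnection S) {L : LocalConn (Fin n → ℂ) (CP n)} (hL : L ∈ S)
    (i : Fin (n + 1)) {p : CP n} (hpL : p ∈ L.dom) (hpi : p ∈ (affineChart i).source)
    {X : VField (Fin n → ℂ) (CP n)}
    (hX : MDifferentiableAt 𝓘(ℂ, Fin n → ℂ) 𝓘(ℂ, Fin n → ℂ).tangent (T% X) p) :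
    ∃ c : ℂ, L.cov X p (X p) - chartConn (affineChart i) X p (X p) = c • X p := by
  by_cases hX0 : X p = 0
  · exact ⟨0, by simp [hX0]⟩
  have hei := affineChart_mem_maximalAtlas (n := n) i
  obtain ⟨A, -, hA⟩ := (hS.connection L hL).exists_christoffel hei
  set v := dChart (affineChart i) p (X p) with hvdef
  have hv : v ≠ 0 := fun h0 => hX0 (dChart_injective hei hpi (by rw [← hvdef, h0, map_zero]))
  obtain ⟨c, hc⟩ := exists_eq_smul_of_forall_dual
    (fun l hl => secondForm_eq_zero hS hL i hpL hpi hv l hl)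
  have hX₀ : MDifferentiableAt 𝓘(ℂ, Fin n → ℂ) 𝓘(ℂ, Fin n → ℂ).tangent
      (T% (chartField (affineChart i) fun _ => v)) p :=
    (contMDiffAt_chartField hei hpi contDiffAt_const).mdifferentiableAt (by simp)
  have hX₀p : dChart (affineChart i) p (chartField (affineChart i) (fun _ => v) p) = v :=
    dChart_dChartSymm hei hpi v
  rw [hA p ⟨hpL, hpi⟩ _ hX₀, hX₀p, fderiv_chartRep_chartField_const hei hpi, zero_apply,
    zero_add] at hc
  refine ⟨c, dChart_injective hei hpi ?_⟩
  rw [map_sub, hA p ⟨hpL, hpi⟩ X hX, dChart_chartConn hei hpi, add_sub_cancel_left, map_smul, ← hc]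

lemma projConnectionEquiv_standard (hS : IsProjConnection S) :
    ProjConnectionEquiv S (standardProjConnection n) := by
  have hT := isProjConnection_standard (n := n)
  have hcomp : ∀ L ∈ S, ∀ L' ∈ standardProjConnection n,
      ProjEquivOn L.cov L'.cov (L.dom ∩ L'.dom) := by
    rintro L hL _ ⟨i, rfl⟩
    refine (projEquivOn_iff (hS.connection L hL)
      (isHolAffineConnection_chartConn (affineChart_mem_maximalAtlas i))
      ((hS.connection L hL).isOpen.inter (affineChart i).open_source)
      inter_subset_left inter_subset_right).2 fun p hp X hX => ?_
    exact cov_sub_chartConn hS hL i hp.1 hp.2 hX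
  refine ⟨?_, ?_, ?_, ?_⟩
  · rw [biUnion_union, hS.cover, univ_union]
  · rintro L (hL | hL)
    exacts [hS.connection L hL, hT.connection L hL]
  · rintro L (hL | hL)
    exacts [hS.torsionFree L hL, hT.torsionFree L hL]
  · rintro L (hL | hL) L' (hL' | hL')
    · exact hS.compatible L hL L' hL'
    · exact hcomp L hL L' hL'
    · rw [inter_comm]
      exact fun D γ => (hcomp L' hL' L hL D γ).symm
    · exact hT.compatible L hL L' hL'

end CP

/-! ### The Schwarzian derivative -/

section Schwarzian

open Filter

/-- The Schwarzian derivative. -/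
noncomputable def schwarzian (f : ℂ → ℂ) (z : ℂ) : ℂ :=
  deriv (deriv (deriv f)) z / deriv f z - 3 / 2 * (deriv (deriv f) z / deriv f z) ^ 2

lemma schwarzian_congr {f g : ℂ → ℂ} {z : ℂ} (h : f =ᶠ[𝓝 z] g) :
    schwarzian f z = schwarzian g z := by
  unfold schwarzian
  rw [h.deriv_eq, h.deriv.deriv_eq, h.deriv.deriv.deriv_eq]

lemma schwarzian_analyticAt {f : ℂ → ℂ} {z : ℂ} (hf : AnalyticAt ℂ f z) (h : deriv f z ≠ 0) :
    AnalyticAt ℂ (schwarzian f) z := by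
  have h2 : AnalyticAt ℂ (fun s => deriv (deriv f) s / deriv f s) z :=
    hf.deriv.deriv.fun_div hf.deriv h
  exact (hf.deriv.deriv.deriv.fun_div hf.deriv h).sub (analyticAt_const.mul (h2.pow 2))

lemma schwarzian_eq_of_hasDerivAt {g g₁ g₂ : ℂ → ℂ} {z g₃ : ℂ}
    (h1 : ∀ᶠ s in 𝓝 z, HasDerivAt g (g₁ s) s) (h2 : ∀ᶠ s in 𝓝 z, HasDerivAt g₁ (g₂ s) s)
    (h3 : HasDerivAt g₂ g₃ z) :
    schwarzian g z = g₃ / g₁ z - 3 / 2 * (g₂ z / g₁ z) ^ 2 := by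
  have e1 : deriv g =ᶠ[𝓝 z] g₁ := h1.mono fun s hs => hs.deriv
  have e2 : deriv (deriv g) =ᶠ[𝓝 z] g₂ := e1.deriv.trans (h2.mono fun s hs => hs.deriv)
  unfold schwarzian
  rw [e1.eq_of_nhds, e2.eq_of_nhds, e2.deriv_eq, h3.deriv]

lemma AnalyticAt.eventually_hasDerivAt {f : ℂ → ℂ} {z : ℂ} (hf : AnalyticAt ℂ f z) :
    ∀ᶠ s in 𝓝 z, HasDerivAt f (deriv f s) s :=
  hf.eventually_analyticAt.mono fun _ hs => hs.differentiableAt.hasDerivAt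

/-- The Schwarzian derivative is invariant under Möbius transformations. -/
lemma schwarzian_moebius {f : ℂ → ℂ} {z a b c d : ℂ} (hf : AnalyticAt ℂ f z)
    (hf' : deriv f z ≠ 0) (hdet : a * d - b * c ≠ 0) (hden : c * f z + d ≠ 0) :
    schwarzian (fun s => (a * f s + b) / (c * f s + d)) z = schwarzian f z := by
  have hne : ∀ᶠ s in 𝓝 z, c * f s + d ≠ 0 :=
    ((hf.continuousAt.const_mul c).add_const d).eventually_ne hden
  have h1 := hf.eventually_hasDerivAt
  have h2 := hf.deriv.eventually_hasDerivAt
  have h3 := hf.deriv.deriv.differentiableAt.hasDerivAt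
  rw [schwarzian_eq_of_hasDerivAt
    (g₁ := fun s => (a * d - b * c) * deriv f s / (c * f s + d) ^ 2)
    (g₂ := fun s => (a * d - b * c) * (deriv (deriv f) s * (c * f s + d) - 2 * c * deriv f s ^ 2)
      / (c * f s + d) ^ 3)
    (g₃ := (a * d - b * c) * (deriv (deriv (deriv f)) z * (c * f z + d) ^ 2
      - 6 * c * deriv f z * deriv (deriv f) z * (c * f z + d) + 6 * c ^ 2 * deriv f z ^ 3)
      / (c * f z + d) ^ 4)]
  · unfold schwarzian
    field_simp
    ring
  · filter_upwards [hne, h1] with s hs hd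
    refine (((hd.const_mul a).add_const b).div ((hd.const_mul c).add_const d) hs).congr_deriv ?_
    field_simp
    ring
  · filter_upwards [hne, h1, h2] with s hs hd hd2
    refine ((hd2.const_mul (a * d - b * c)).div (((hd.const_mul c).add_const d).pow 2)
      (pow_ne_zero 2 hs)).congr_deriv ?_
    simp only [Pi.pow_apply]
    field_simp
    ring
  · have hd := h1.self_of_nhds
    have hd2 := h2.self_of_nhds
    refine ((((h3.mul ((hd.const_mul c).add_const d)).sub
      ((hd2.pow 2).const_mul (2 * c))).const_mul (a * d - b * c)).div
      (((hd.const_mul c).add_const d).pow 3) (pow_ne_zero 3 hden)).congr_deriv ?_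
    simp only [Pi.pow_apply, Pi.mul_apply, Pi.sub_apply]
    field_simp
    ring

/-- An instance of the cocycle rule `S(f ∘ g) = (S f ∘ g) g'² + S g` with `g = 1/s`, for which `S g
= 0` and `g'² = s⁻⁴`. -/
lemma schwarzian_comp_inv {f : ℂ → ℂ} {z : ℂ} (hz : z ≠ 0) (hf : AnalyticAt ℂ f z⁻¹) :
    schwarzian (fun s => f s⁻¹) z = schwarzian f z⁻¹ * z⁻¹ ^ 4 := by
  have hinv : Tendsto (fun s : ℂ => s⁻¹) (𝓝 z) (𝓝 z⁻¹) := (continuousAt_inv₀ hz).tendsto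
  have hne : ∀ᶠ s in 𝓝 z, s ≠ 0 := isOpen_ne.mem_nhds hz
  have h1 := hinv.eventually hf.eventually_hasDerivAt
  have h2 := hinv.eventually hf.deriv.eventually_hasDerivAt
  have h3 := hf.deriv.deriv.differentiableAt.hasDerivAt
  rw [schwarzian_eq_of_hasDerivAt
    (g₁ := fun s => -(deriv f s⁻¹ / s ^ 2))
    (g₂ := fun s => deriv (deriv f) s⁻¹ / s ^ 4 + 2 * deriv f s⁻¹ / s ^ 3)
    (g₃ := -(deriv (deriv (deriv f)) z⁻¹ / z ^ 6) - 6 * deriv (deriv f) z⁻¹ / z ^ 5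
      - 6 * deriv f z⁻¹ / z ^ 4)]
  · unfold schwarzian
    field_simp
    ring
  · filter_upwards [hne, h1] with s hs hd
    refine (hd.comp s (hasDerivAt_inv hs)).congr_deriv ?_
    field_simp
  · filter_upwards [hne, h2] with s hs hd
    refine (((hd.comp s (hasDerivAt_inv hs)).div (hasDerivAt_pow 2 s)
      (pow_ne_zero 2 hs)).neg).congr_deriv ?_
    simp only [Function.comp_apply]
    field_simp
    simp
    ring
  · have hd := h2.self_of_nhds
    refine (((h3.comp z (hasDerivAt_inv hz)).div (hasDerivAt_pow 4 z) (pow_ne_zero 4 hz)).add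
      (((hd.comp z (hasDerivAt_inv hz)).const_mul 2).div (hasDerivAt_pow 3 z)
      (pow_ne_zero 3 hz))).congr_deriv ?_
    simp only [Function.comp_apply]
    field_simp
    simp
    ring

/-- An analytic solution of `h' = h² / 2` which vanishes at a point vanishes near it. -/
lemma eventually_eq_zero_of_riccati {h : ℂ → ℂ} {z : ℂ} (hh : AnalyticAt ℂ h z) (h0 : h z = 0)
    (hode : ∀ᶠ s in 𝓝 z, deriv h s = 1 / 2 * h s ^ 2) : ∀ᶠ s in 𝓝 z, h s = 0 := by
  rw [← analyticOrderAt_eq_top]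
  by_contra htop
  -- A finite order of vanishing `m` would satisfy `2m + 1 = m`: differentiation lowers the order by
  -- one, squaring doubles it.
  have h1 := hh.analyticOrderAt_deriv_add_one
  have h2 : analyticOrderAt (deriv h) z = 2 • analyticOrderAt h z := by
    rw [analyticOrderAt_congr hode, ← analyticOrderAt_pow hh 2]
    have : (fun s => 1 / 2 * h s ^ 2) = (fun _ : ℂ => (1 / 2 : ℂ)) * (h ^ 2) := rfl
    rw [this, analyticOrderAt_mul analyticAt_const (hh.pow 2),
      (analyticAt_const (v := (1 / 2 : ℂ))).analyticOrderAt_eq_zero.2 (by norm_num), zero_add]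
  simp only [h0, sub_zero] at h1
  rw [h2] at h1
  obtain ⟨m, hm⟩ := ENat.ne_top_iff_exists.1 htop
  rw [← hm, nsmul_eq_mul] at h1
  norm_cast at h1
  omega

/-- A function with vanishing Schwarzian derivative is a Möbius transformation. -/
lemma exists_moebius_of_schwarzian_eq_zero {f : ℂ → ℂ} {z : ℂ} (hf : AnalyticAt ℂ f z)
    (hf' : deriv f z ≠ 0) (hS : ∀ᶠ s in 𝓝 z, schwarzian f s = 0) :
    ∃ a b c d : ℂ, a * d - b * c ≠ 0 ∧ c * z + d ≠ 0 ∧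
      ∀ᶠ s in 𝓝 z, f s = (a * s + b) / (c * s + d) := by
  set w := f z with hw
  -- `G` is `(f - w) / (1 + k (f - w))`, and this `k` is the one for which `G'' = 0` at `z`; also `G
  -- = 0` and `G' = f'` there.
  set k := deriv (deriv f) z / (2 * deriv f z ^ 2) with hk
  let G : ℂ → ℂ := fun s => (1 * f s + -w) / (k * f s + (1 - k * w))
  have hdet : (1 : ℂ) * (1 - k * w) - -w * k ≠ 0 := by ring_nf; exact one_ne_zero
  have hden : k * f z + (1 - k * w) ≠ 0 := by rw [← hw]; ring_nf; exact one_ne_zero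
  have hdenE : ∀ᶠ s in 𝓝 z, k * f s + (1 - k * w) ≠ 0 :=
    ((hf.continuousAt.const_mul k).add_const _).eventually_ne hden
  have hGan : AnalyticAt ℂ G z :=
    ((analyticAt_const.mul hf).add analyticAt_const).div
      ((analyticAt_const.mul hf).add analyticAt_const) hden
  have hGS : ∀ᶠ s in 𝓝 z, schwarzian G s = 0 := by
    filter_upwards [hdenE, hS, hf.eventually_analyticAt,
      hf.deriv.continuousAt.eventually_ne hf'] with s hs hs0 hfs hfs'
    rw [← hs0]
    exact schwarzian_moebius hfs hfs' hdet hs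
  have hG1 : ∀ᶠ s in 𝓝 z, HasDerivAt G (deriv f s / (k * f s + (1 - k * w)) ^ 2) s := by
    filter_upwards [hdenE, hf.eventually_hasDerivAt] with s hs hd
    refine (((hd.const_mul 1).add_const (-w)).div ((hd.const_mul k).add_const (1 - k * w))
      hs).congr_deriv ?_
    field_simp
    ring
  have hG1' : deriv G =ᶠ[𝓝 z] fun s => deriv f s / (k * f s + (1 - k * w)) ^ 2 :=
    hG1.mono fun s hs => hs.deriv
  have hwz : k * f z + (1 - k * w) = 1 := by rw [← hw]; ring
  have hG1z : deriv G z = deriv f z := by rw [hG1'.eq_of_nhds, hwz]; simp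
  have hG2z : deriv (deriv G) z = 0 := by
    rw [hG1'.deriv_eq]
    have hd := hf.differentiableAt.hasDerivAt
    have hd2 := hf.deriv.differentiableAt.hasDerivAt
    have := (hd2.div (((hd.const_mul k).add_const (1 - k * w)).pow 2) (pow_ne_zero 2 hden)).deriv
    refine this.trans ?_
    have hk' : 2 * k * deriv f z ^ 2 = deriv (deriv f) z := by
      rw [hk]
      field_simp
    simp only [Pi.pow_apply, hwz, one_pow, div_one, mul_one, Nat.cast_ofNat]
    linear_combination -hk'
  have hG1ne : deriv G z ≠ 0 := hG1z ▸ hf'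
  have hG1neE : ∀ᶠ s in 𝓝 z, deriv G s ≠ 0 := hGan.deriv.continuousAt.eventually_ne hG1ne
  have hhan : AnalyticAt ℂ (fun s => deriv (deriv G) s / deriv G s) z :=
    hGan.deriv.deriv.fun_div hGan.deriv hG1ne
  -- For `h = G'' / G'`, vanishing of the Schwarzian reads `h' = h² / 2`, and `h` vanishes at `z` by
  -- the choice of `k`. So `G` is affine near `z`.
  have hzero := eventually_eq_zero_of_riccati hhan (by simp [hG2z]) (by
    filter_upwards [hGS, hG1neE, hGan.deriv.eventually_hasDerivAt,
      hGan.deriv.deriv.eventually_hasDerivAt] with s hs hne hd2 hd3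
    rw [(hd3.fun_div hd2 hne).deriv]
    unfold schwarzian at hs
    field_simp at hs ⊢
    linear_combination hs)
  have hG2 : ∀ᶠ s in 𝓝 z, deriv (deriv G) s = 0 := by
    filter_upwards [hzero, hG1neE] with s hs hne
    exact (div_eq_zero_iff.1 hs).resolve_right hne
  set α := deriv f z with hα
  have hconst : ∀ (F : ℂ → ℂ), (∀ᶠ s in 𝓝 z, HasDerivAt F 0 s) → ∀ᶠ s in 𝓝 z, F s = F z := by
    intro F hF
    obtain ⟨r, hr, hball⟩ := Metric.eventually_nhds_iff_ball.1 hF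
    filter_upwards [Metric.ball_mem_nhds z hr] with s hs
    have := (convex_ball z r).norm_image_sub_le_of_norm_hasDerivWithin_le (C := 0)
      (fun t ht => (hball t ht).hasDerivWithinAt) (fun t ht => by simp) (Metric.mem_ball_self hr) hs
    simpa [sub_eq_zero] using this
  have hGα : ∀ᶠ s in 𝓝 z, deriv G s = α := by
    rw [← hG1z]
    refine hconst _ ?_
    filter_upwards [hG2, hGan.deriv.eventually_hasDerivAt] with s hs hd
    exact hd.congr_deriv hs
  have hGlin : ∀ᶠ s in 𝓝 z, G s - α * (s - z) = G z - α * (z - z) := by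
    refine hconst (fun s => G s - α * (s - z)) ?_
    filter_upwards [hGα, hGan.eventually_hasDerivAt] with s hs hd
    refine (hd.sub (((hasDerivAt_id s).sub_const z).const_mul α)).congr_deriv ?_
    simp [hs]
  have hGz : G z = 0 := by simp [G, ← hw]
  -- The coefficients come from solving `(f - w) / (1 + k (f - w)) = α (s - z)` for `f`.
  refine ⟨α - w * k * α, w + w * k * α * z - α * z, -(k * α), 1 + k * α * z, ?_, ?_, ?_⟩
  · have : (α - w * k * α) * (1 + k * α * z) - (w + w * k * α * z - α * z) * -(k * α) = α := by
      ring
    rwa [this]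
  · have : -(k * α) * z + (1 + k * α * z) = 1 := by ring
    rw [this]
    exact one_ne_zero
  · have hcont : ∀ᶠ s in 𝓝 z, -(k * α) * s + (1 + k * α * z) ≠ 0 := by
      refine ContinuousAt.eventually_ne (by fun_prop) ?_
      ring_nf
      exact one_ne_zero
    filter_upwards [hGlin, hdenE, hcont] with s hs hne hne'
    rw [hGz, sub_self, mul_zero, sub_zero, sub_eq_zero] at hs
    simp only [G] at hs
    rw [div_eq_iff hne] at hs
    rw [eq_div_iff hne']
    linear_combination hs

end Schwarzian

/-! ### Affine coordinates and projective transformations of the projective line -/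

namespace CP

open Filter Set

/-- The affine coordinate on the projective line. -/
noncomputable def coord (i : Fin 2) (p : CP 1) : ℂ := affineChart i p 0

/-- The inverse of the affine coordinate on the projective line. -/
noncomputable def param (i : Fin 2) (z : ℂ) : CP 1 := (affineChart i).symm fun _ => z

lemma param_mem_source (i : Fin 2) (z : ℂ) : param i z ∈ (affineChart i).source :=
  (affineChart i).map_target (mem_univ _)

lemma coord_param (i : Fin 2) (z : ℂ) : coord i (param i z) = z :=
  congrFun ((affineChart i).right_inv (mem_univ _)) 0

lemma param_coord {i : Fin 2} {p : CP 1} (hp : p ∈ (affineChart i).source) :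
    param i (coord i p) = p := by
  have : (fun _ : Fin 1 => coord i p) = affineChart i p := by
    ext k
    rw [Subsingleton.elim k 0]
    rfl
  rw [param, this, (affineChart i).left_inv hp]

lemma contMDiff_param (i : Fin 2) : ContMDiff 𝓘(ℂ, ℂ) 𝓘(ℂ, Fin 1 → ℂ) ω (param i) := by
  intro z
  have h1 : ContMDiffAt 𝓘(ℂ, ℂ) 𝓘(ℂ, Fin 1 → ℂ) ω (fun z : ℂ => (fun _ : Fin 1 => z)) z :=
    (contDiff_pi.2 fun _ => contDiff_id).contMDiff.contMDiffAt
  exact (contMDiffAt_symm_of_mem_maximalAtlas (affineChart_mem_maximalAtlas i)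
    (mem_univ _)).comp z h1

lemma contMDiffAt_coord {i : Fin 2} {p : CP 1} (hp : p ∈ (affineChart i).source) :
    ContMDiffAt 𝓘(ℂ, Fin 1 → ℂ) 𝓘(ℂ, ℂ) ω (coord i) p := by
  have h1 : ContMDiffAt 𝓘(ℂ, Fin 1 → ℂ) 𝓘(ℂ, ℂ) ω (fun v : Fin 1 → ℂ => v 0) (affineChart i p) :=
    (contDiff_apply ℂ ℂ (0 : Fin 1)).contMDiff.contMDiffAt
  exact h1.comp p (contMDiffAt_of_mem_maximalAtlas (affineChart_mem_maximalAtlas i) hp)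

/-- A map of the projective line to itself in affine coordinates. -/
noncomputable def coordRep (i j : Fin 2) (φ : CP 1 → CP 1) (z : ℂ) : ℂ := coord j (φ (param i z))

lemma analyticAt_coordRep {i j : Fin 2} {φ : CP 1 → CP 1} {z : ℂ}
    (hφ : ContMDiffAt 𝓘(ℂ, Fin 1 → ℂ) 𝓘(ℂ, Fin 1 → ℂ) ω φ (param i z))
    (hj : φ (param i z) ∈ (affineChart j).source) : AnalyticAt ℂ (coordRep i j φ) z :=
  (((contMDiffAt_coord hj).comp z (hφ.comp z (contMDiff_param i z))).contDiffAt).analyticAt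

/-- The inverse of `φ` also has a holomorphic expression, so the chain rule makes the derivative a
factor of `1`. -/
lemma deriv_coordRep_ne_zero {i j : Fin 2} {φ : OpenPartialHomeomorph (CP 1) (CP 1)} {z : ℂ}
    (hφ : ContMDiffOn 𝓘(ℂ, Fin 1 → ℂ) 𝓘(ℂ, Fin 1 → ℂ) ω φ φ.source)
    (hφ' : ContMDiffOn 𝓘(ℂ, Fin 1 → ℂ) 𝓘(ℂ, Fin 1 → ℂ) ω φ.symm φ.target)
    (hz : param i z ∈ φ.source) (hj : φ (param i z) ∈ (affineChart j).source) :
    deriv (coordRep i j φ) z ≠ 0 := by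
  have hw : param j (coordRep i j φ z) = φ (param i z) := param_coord hj
  have hw' : φ.symm (φ (param i z)) = param i z := φ.left_inv hz
  have h1 := analyticAt_coordRep (j := j) (hφ.contMDiffAt (φ.open_source.mem_nhds hz)) hj
  have h2 : AnalyticAt ℂ (coordRep j i φ.symm) (coordRep i j φ z) := by
    refine analyticAt_coordRep ?_ ?_
    · rw [hw]
      exact hφ'.contMDiffAt (φ.open_target.mem_nhds (φ.map_source hz))
    · rw [hw, hw']
      exact param_mem_source i z
  have hcont : ContinuousAt (fun s => φ (param i s)) z :=
    ((hφ.contMDiffAt (φ.open_source.mem_nhds hz)).continuousAt).comp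
      (contMDiff_param i).continuous.continuousAt
  have hid : coordRep j i φ.symm ∘ coordRep i j φ =ᶠ[𝓝 z] id := by
    filter_upwards [hcont.eventually ((affineChart j).open_source.mem_nhds hj),
      (contMDiff_param i).continuous.continuousAt.eventually (φ.open_source.mem_nhds hz)]
      with s hs hs'
    change coord i (φ.symm (param j (coord j (φ (param i s))))) = s
    rw [param_coord hs, φ.left_inv hs', coord_param]
  have h3 := (h2.differentiableAt.hasDerivAt.comp z h1.differentiableAt.hasDerivAt).deriv
  rw [hid.deriv_eq, deriv_id] at h3
  intro h0
  rw [h0, mul_zero] at h3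
  exact one_ne_zero h3

lemma param_eq_param_inv (i : Fin 2) {z : ℂ} (hz : z ≠ 0) :
    param i z = param (i.succAbove 0) z⁻¹ := by
  change Projectivization.mk ℂ _ _ = Projectivization.mk ℂ _ _
  rw [Projectivization.mk_eq_mk_iff']
  refine ⟨z, ?_⟩
  ext l
  fin_cases i <;> fin_cases l <;> simp [hz, Fin.insertNth, Fin.succAboveCases]

lemma coord_mk (j : Fin 2) (v : Fin 2 → ℂ) (hv : v ≠ 0) :
    coord j (Projectivization.mk ℂ v hv) = v (j.succAbove 0) / v j := rfl

lemma mk_mem_affineChart_source (j : Fin 2) (v : Fin 2 → ℂ) (hv : v ≠ 0) :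
    Projectivization.mk ℂ v hv ∈ (affineChart j).source ↔ v j ≠ 0 :=
  mk_mem_affineDomain j v hv

lemma smul_param (g : GL (Fin 2) ℂ) (i : Fin 2) (z : ℂ) :
    (.mk g : PGL(Fin 2, ℂ)) • param i z =
      Projectivization.mk ℂ (g • (i.insertNth (1 : ℂ) (fun _ => z) : Fin 2 → ℂ))
        ((smul_ne_zero_iff_ne g).2 (insertNth_ne_zero i _)) := rfl

lemma smul_insertNth (g : GL (Fin 2) ℂ) (i : Fin 2) (z : ℂ) (l : Fin 2) :
    (g • (i.insertNth (1 : ℂ) (fun _ => z) : Fin 2 → ℂ)) l =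
      g.1 l (i.succAbove 0) * z + g.1 l i := by
  change (g.1.mulVec _) l = _
  fin_cases i <;> simp [Matrix.mulVec, dotProduct, Fin.sum_univ_two, Fin.insertNth,
    Fin.succAboveCases]
  ring

lemma smul_param_mem_source_iff (g : GL (Fin 2) ℂ) (i j : Fin 2) (z : ℂ) :
    (.mk g : PGL(Fin 2, ℂ)) • param i z ∈ (affineChart j).source ↔
      g.1 j (i.succAbove 0) * z + g.1 j i ≠ 0 := by
  rw [smul_param, mk_mem_affineChart_source, smul_insertNth]

/-- The expression of a projective transformation in affine coordinates. -/
lemma coord_smul_param (g : GL (Fin 2) ℂ) (i j : Fin 2) (z : ℂ) :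
    coord j ((.mk g : PGL(Fin 2, ℂ)) • param i z) =
      (g.1 (j.succAbove 0) (i.succAbove 0) * z + g.1 (j.succAbove 0) i) /
        (g.1 j (i.succAbove 0) * z + g.1 j i) := by
  rw [smul_param, coord_mk, smul_insertNth, smul_insertNth]

lemma minor_ne_zero (g : GL (Fin 2) ℂ) (i j : Fin 2) :
    g.1 (j.succAbove 0) (i.succAbove 0) * g.1 j i -
      g.1 (j.succAbove 0) i * g.1 j (i.succAbove 0) ≠ 0 := by
  have hdet : g.1.det ≠ 0 := by
    have := g.det.ne_zero
    simpa using this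
  rw [Matrix.det_fin_two] at hdet
  fin_cases i <;> fin_cases j <;> simp <;> intro h <;> apply hdet <;> first
    | linear_combination h
    | linear_combination -h

lemma exists_smul_param_of_moebius (i j : Fin 2) {a b c d : ℂ} (h : a * d - b * c ≠ 0) :
    ∃ g : PGL(Fin 2, ℂ), ∀ z, c * z + d ≠ 0 →
      g • param i z = param j ((a * z + b) / (c * z + d)) := by
  -- Row `j` holds the denominator and column `i` the constant terms, because the affine
  -- parametrization puts `1` in place `i`.
  let m : Matrix (Fin 2) (Fin 2) ℂ := fun l k =>
    if l = j then (if k = i then d else c) else (if k = i then b else a)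
  have hm : m.det ≠ 0 := by
    rw [Matrix.det_fin_two]
    fin_cases i <;> fin_cases j <;> simp [m] <;> intro h' <;> apply h <;> first
      | linear_combination h'
      | linear_combination -h'
  have hj : m j (i.succAbove 0) = c ∧ m j i = d := by simp [m, Fin.succAbove_ne]
  have hj' : m (j.succAbove 0) (i.succAbove 0) = a ∧ m (j.succAbove 0) i = b := by
    simp [m, Fin.succAbove_ne]
  let g : GL (Fin 2) ℂ := Matrix.GeneralLinearGroup.mkOfDetNeZero m hm
  have hg : g.1 = m := rfl
  refine ⟨.mk g, fun z hz => ?_⟩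
  have hmem := (smul_param_mem_source_iff g i j z).2 (by rwa [hg, hj.1, hj.2])
  rw [← param_coord hmem, coord_smul_param, hg, hj.1, hj.2, hj'.1, hj'.2]

/-- A projective transformation is determined by its values on a nonempty open set. -/
lemma eq_of_smul_eventuallyEq {g g' : PGL(Fin 2, ℂ)} {x : CP 1}
    (h : ∀ᶠ y in 𝓝 x, g • y = g' • y) : g = g' := by
  obtain ⟨i, hi⟩ := exists_mem_affineDomain x
  obtain ⟨m, hm⟩ := Matrix.ProjGenLinGroup.mk_surjective (g'⁻¹ * g)
  suffices Matrix.ProjGenLinGroup.mk m = 1 by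
    rw [this] at hm
    exact (inv_mul_eq_one.1 hm.symm).symm
  have hcont : Tendsto (param i) (𝓝 (coord i x)) (𝓝 x) := by
    have := (contMDiff_param i).continuous.tendsto (coord i x)
    rwa [param_coord hi] at this
  -- In the coordinate, fixing every nearby point is the vanishing of a polynomial of degree at most
  -- two on an open set; all its coefficients must be zero, which makes the matrix scalar.
  have hfix : ∀ᶠ s in 𝓝 (coord i x), m.1 (i.succAbove 0) (i.succAbove 0) * s +
      m.1 (i.succAbove 0) i = s * (m.1 i (i.succAbove 0) * s + m.1 i i) := by
    filter_upwards [hcont.eventually h] with s hs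
    have h1 : (.mk m : PGL(Fin 2, ℂ)) • param i s = param i s := by
      rw [hm, mul_smul, hs, inv_smul_smul]
    have h2 : m.1 i (i.succAbove 0) * s + m.1 i i ≠ 0 := by
      rw [← smul_param_mem_source_iff, h1]
      exact param_mem_source i s
    have h3 := coord_smul_param m i i s
    rw [h1, coord_param, eq_div_iff h2] at h3
    exact h3.symm
  obtain ⟨r, hr, hball⟩ := Metric.eventually_nhds_iff_ball.1 hfix
  set z := coord i x
  have hε : ((r / 2 : ℝ) : ℂ) ≠ 0 := by
    exact_mod_cast (half_pos hr).ne'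
  have hn : ‖((r / 2 : ℝ) : ℂ)‖ < r := by
    rw [Complex.norm_real, Real.norm_of_nonneg (half_pos hr).le]
    linarith
  have e0 := hball z (Metric.mem_ball_self hr)
  have e1 := hball (z + (r / 2 : ℝ)) (by simpa [mem_ball_iff_norm] using hn)
  have e2 := hball (z - (r / 2 : ℝ)) (by simpa [mem_ball_iff_norm] using hn)
  set ε : ℂ := ((r / 2 : ℝ) : ℂ)
  -- The second difference at `z - ε`, `z`, `z + ε` isolates the quadratic coefficient.
  have hc : m.1 i (i.succAbove 0) = 0 := by
    have : m.1 i (i.succAbove 0) * ε ^ 2 = 0 := by linear_combination e0 - (e1 + e2) / 2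
    exact (mul_eq_zero.1 this).resolve_right (pow_ne_zero 2 hε)
  have ha : m.1 (i.succAbove 0) (i.succAbove 0) = m.1 i i := by
    have : (m.1 (i.succAbove 0) (i.succAbove 0) - m.1 i i) * ε = 0 := by
      rw [hc] at e0 e1
      linear_combination e1 - e0
    exact sub_eq_zero.1 ((mul_eq_zero.1 this).resolve_right hε)
  have hb : m.1 (i.succAbove 0) i = 0 := by
    rw [hc, ha] at e0
    linear_combination e0
  have hne := minor_ne_zero m i i
  rw [hc, ha, mul_zero, sub_zero] at hne
  rw [← Matrix.ProjGenLinGroup.mk_one, eq_comm, Matrix.ProjGenLinGroup.mk_eq_mk_iff]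
  refine ⟨Units.mk0 (m.1 i i) (left_ne_zero_of_mul hne), ?_⟩
  rw [one_mul]
  ext l k
  fin_cases i <;> fin_cases l <;> fin_cases k <;> simp_all

end CP

/-! ### Uniqueness of the projective structure -/

namespace CP

open Filter Set

variable {S : Set (OpenPartialHomeomorph (CP 1) (CP 1))}

/-- The projective line is locally connected, so a component of an open overlap is a neighbourhood
of each of its points. -/
lemma eventually_eq_smul (hS : IsProjStructure S) {φ ψ : OpenPartialHomeomorph (CP 1) (CP 1)}
    (hφ : φ ∈ S) (hψ : ψ ∈ S) {x : CP 1} (hx : x ∈ φ.source ∩ ψ.source) :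
    ∃ g : PGL(Fin 2, ℂ), ∀ᶠ y in 𝓝 x, φ y = g • ψ y := by
  have : LocallyConnectedSpace (CP 1) := ChartedSpace.locallyConnectedSpace (Fin 1 → ℂ) (CP 1)
  obtain ⟨g, hg⟩ := hS.transition φ hφ ψ hψ x hx
  refine ⟨g, ?_⟩
  filter_upwards [((φ.open_source.inter ψ.open_source).connectedComponentIn (x := x)).mem_nhds
    (mem_connectedComponentIn hx)] with y hy using hg y hy

lemma eventually_param_mem {φ : OpenPartialHomeomorph (CP 1) (CP 1)} {i j : Fin 2} {z : ℂ}
    (hz : param i z ∈ φ.source) (hj : φ (param i z) ∈ (affineChart j).source) :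
    ∀ᶠ s in 𝓝 z, param i s ∈ φ.source ∧ φ (param i s) ∈ (affineChart j).source := by
  have hcont : ContinuousAt (param i) z := (contMDiff_param i).continuous.continuousAt
  have hcont' : ContinuousAt (fun s => φ (param i s)) z :=
    (φ.continuousAt hz).comp hcont
  exact (hcont.eventually (φ.open_source.mem_nhds hz)).and
    (hcont'.eventually ((affineChart j).open_source.mem_nhds hj))

/-- The Schwarzian derivatives of the members of a projective structure agree. -/
lemma schwarzian_coordRep_eq (hS : IsProjStructure S)
    {φ ψ : OpenPartialHomeomorph (CP 1) (CP 1)} (hφ : φ ∈ S) (hψ : ψ ∈ S) {i j j' : Fin 2} {z : ℂ}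
    (hzφ : param i z ∈ φ.source) (hzψ : param i z ∈ ψ.source)
    (hj : φ (param i z) ∈ (affineChart j).source) (hj' : ψ (param i z) ∈ (affineChart j').source) :
    schwarzian (coordRep i j φ) z = schwarzian (coordRep i j' ψ) z := by
  obtain ⟨g, hg⟩ := eventually_eq_smul hS hφ hψ ⟨hzφ, hzψ⟩
  obtain ⟨g, rfl⟩ := Matrix.ProjGenLinGroup.mk_surjective g
  have hcont : ContinuousAt (param i) z := (contMDiff_param i).continuous.continuousAt
  have hpar : ∀ s, ψ (param i s) ∈ (affineChart j').source →
      param j' (coordRep i j' ψ s) = ψ (param i s) := fun s hs => param_coord hs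
  have hden : g.1 j (j'.succAbove 0) * coordRep i j' ψ z + g.1 j j' ≠ 0 := by
    rw [← smul_param_mem_source_iff, hpar z hj', ← hg.self_of_nhds]
    exact hj
  rw [← schwarzian_moebius (analyticAt_coordRep
    ((hS.holo ψ hψ).contMDiffAt (ψ.open_source.mem_nhds hzψ)) hj')
    (deriv_coordRep_ne_zero (hS.holo ψ hψ) (hS.holo_symm ψ hψ) hzψ hj')
    (minor_ne_zero g j' j) hden]
  refine schwarzian_congr ?_
  filter_upwards [hcont.eventually hg, eventually_param_mem hzψ hj'] with s hs hs'
  rw [← coord_smul_param, hpar s hs'.2, ← hs]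
  rfl

/-- The Schwarzian derivatives of the members of a projective structure vanish. -/
lemma schwarzian_coordRep_eq_zero (hS : IsProjStructure S)
    {φ : OpenPartialHomeomorph (CP 1) (CP 1)} (hφ : φ ∈ S) {i j : Fin 2} {z : ℂ}
    (hz : param i z ∈ φ.source) (hj : φ (param i z) ∈ (affineChart j).source) :
    schwarzian (coordRep i j φ) z = 0 := by
  have hex : ∀ x : CP 1, ∃ ψ ∈ S, x ∈ ψ.source := by
    intro x
    have := hS.cover ▸ mem_univ x
    simpa using this
  choose Φ hΦ hΦs using hex
  choose J hJ using fun x : CP 1 => exists_mem_affineDomain (Φ x x)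
  -- The quadratic differential in coordinate `i`, with member and target chart chosen pointwise;
  -- `hq` shows the choices do not matter, so it is entire.
  let q : Fin 2 → ℂ → ℂ := fun i z =>
    schwarzian (coordRep i (J (param i z)) (Φ (param i z))) z
  have hq : ∀ i z, ∀ ψ ∈ S, ∀ j, param i z ∈ ψ.source → ψ (param i z) ∈ (affineChart j).source →
      q i z = schwarzian (coordRep i j ψ) z := fun i z ψ hψ j hz hj =>
    schwarzian_coordRep_eq hS (hΦ _) hψ (hΦs _) hz (hJ _) hj
  have hdiff : ∀ i, Differentiable ℂ (q i) := by
    intro i z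
    have h1 := schwarzian_analyticAt (analyticAt_coordRep
      ((hS.holo _ (hΦ (param i z))).contMDiffAt ((Φ _).open_source.mem_nhds (hΦs _))) (hJ _))
      (deriv_coordRep_ne_zero (hS.holo _ (hΦ _)) (hS.holo_symm _ (hΦ _)) (hΦs _) (hJ (param i z)))
    refine h1.differentiableAt.congr_of_eventuallyEq ?_
    filter_upwards [eventually_param_mem (hΦs (param i z)) (hJ _)] with s hs
    exact hq i s _ (hΦ _) _ hs.1 hs.2
  have hinv : ∀ i z, z ≠ 0 → q i z = q (i.succAbove 0) z⁻¹ * z⁻¹ ^ 4 := by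
    intro i z hz
    have hp := param_eq_param_inv i hz
    set i' := i.succAbove 0
    have h1 := hΦs (param i z)
    have h2 := hJ (param i z)
    have h1' : param i' z⁻¹ ∈ (Φ (param i z)).source := hp ▸ h1
    have h2' : Φ (param i z) (param i' z⁻¹) ∈ (affineChart (J (param i z))).source := by
      rw [← hp]
      exact h2
    rw [hq i' z⁻¹ _ (hΦ (param i z)) _ h1' h2']
    rw [← schwarzian_comp_inv hz (analyticAt_coordRep
      ((hS.holo _ (hΦ (param i z))).contMDiffAt ((Φ _).open_source.mem_nhds h1')) h2')]
    refine schwarzian_congr ?_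
    filter_upwards [isOpen_ne.mem_nhds hz] with s hs
    unfold coordRep
    rw [param_eq_param_inv i hs]
  -- Near infinity the other expression stays bounded, being continuous at `0`, and the factor `z⁻⁴`
  -- forces decay.
  have hlim : ∀ i, Tendsto (q i) (cocompact ℂ) (𝓝 0) := by
    intro i
    have h0 : Tendsto (fun z : ℂ => z⁻¹) (cocompact ℂ) (𝓝 0) := by
      rw [← Metric.cobounded_eq_cocompact]
      exact tendsto_inv₀_cobounded
    have h1 := (((hdiff (i.succAbove 0)).continuous.tendsto 0).comp h0).mul (h0.pow 4)
    rw [zero_pow (by norm_num), mul_zero] at h1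
    refine h1.congr' ?_
    filter_upwards [(isCompact_singleton (x := (0 : ℂ))).compl_mem_cocompact] with z hz
    exact (hinv i z hz).symm
  rw [← hq i z φ hφ j hz hj]
  exact (hdiff i).apply_eq_of_tendsto_cocompact z (hlim i)

lemma eventually_eq_smul_self (hS : IsProjStructure S)
    {φ : OpenPartialHomeomorph (CP 1) (CP 1)} (hφ : φ ∈ S) {x : CP 1} (hx : x ∈ φ.source) :
    ∃ g : PGL(Fin 2, ℂ), ∀ᶠ y in 𝓝 x, φ y = g • y := by
  obtain ⟨i, hi⟩ := exists_mem_affineDomain x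
  obtain ⟨j, hj⟩ := exists_mem_affineDomain (φ x)
  have hi' : x ∈ (affineChart i).source := hi
  have hxi : param i (coord i x) = x := param_coord hi'
  have hz : param i (coord i x) ∈ φ.source := by rwa [hxi]
  have hj' : φ (param i (coord i x)) ∈ (affineChart j).source := by rw [hxi]; exact hj
  have hev := eventually_param_mem hz hj'
  obtain ⟨a, b, c, d, hdet, hden, hf⟩ := exists_moebius_of_schwarzian_eq_zero
    (analyticAt_coordRep ((hS.holo φ hφ).contMDiffAt (φ.open_source.mem_nhds hz)) hj')
    (deriv_coordRep_ne_zero (hS.holo φ hφ) (hS.holo_symm φ hφ) hz hj')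
    (hev.mono fun s hs => schwarzian_coordRep_eq_zero hS hφ hs.1 hs.2)
  obtain ⟨g, hg⟩ := exists_smul_param_of_moebius i j hdet
  have hdenE : ∀ᶠ s in 𝓝 (coord i x), c * s + d ≠ 0 :=
    ContinuousAt.eventually_ne (by fun_prop) hden
  refine ⟨g, ?_⟩
  filter_upwards [(contMDiffAt_coord hi').continuousAt.eventually (hev.and (hf.and hdenE)),
    (affineChart i).open_source.mem_nhds hi'] with y hy hyi
  have h1 := hg _ hy.2.2
  rw [← hy.2.1, param_coord hyi] at h1
  have h2 : param j (coordRep i j φ (coord i y)) = φ (param i (coord i y)) :=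
    param_coord hy.1.2
  rw [h1, h2, param_coord hyi]

/-- The transformation that represents `φ` near a point is locally constant, since two that agree on
a nonempty open set are equal. Hence it is constant on a connected set. -/
lemma exists_eq_smul_on_component (hS : IsProjStructure S)
    {φ : OpenPartialHomeomorph (CP 1) (CP 1)} (hφ : φ ∈ S) {x : CP 1} (hx : x ∈ φ.source) :
    ∃ g : PGL(Fin 2, ℂ), ∀ y ∈ connectedComponentIn φ.source x, φ y = g • y := by
  have hex : ∀ y, ∃ g : PGL(Fin 2, ℂ), y ∈ φ.source → ∀ᶠ w in 𝓝 y, φ w = g • w := by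
    intro y
    by_cases hy : y ∈ φ.source
    · obtain ⟨g, hg⟩ := eventually_eq_smul_self hS hφ hy
      exact ⟨g, fun _ => hg⟩
    · exact ⟨1, fun h => absurd h hy⟩
  choose G hG using hex
  have hsub := connectedComponentIn_subset φ.source x
  refine ⟨G x, fun y hy => ?_⟩
  have hconst : G x = G y := by
    refine isPreconnected_connectedComponentIn.induction₂ (fun y y' => G y = G y')
      (fun y hy => ?_) (fun _ _ _ _ _ _ h h' => h.trans h') (fun _ _ _ _ h => h.symm)
      (mem_connectedComponentIn hx) hy
    refine eventually_nhdsWithin_of_eventually_nhds ?_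
    filter_upwards [(hG y (hsub hy)).eventually_nhds, φ.open_source.mem_nhds (hsub hy)]
      with y' hy' hys
    refine eq_of_smul_eventuallyEq (x := y') ?_
    filter_upwards [hy', hG y' hys] with w hw hw'
    rw [← hw, hw']
  rw [hconst]
  exact (hG y (hsub hy)).self_of_nhds

lemma isProjStructure_standard : IsProjStructure (standardProjStructure 1) where
  cover := by simp [standardProjStructure]
  holo := by
    rintro _ rfl
    exact contMDiffOn_id
  holo_symm := by
    rintro _ rfl
    exact contMDiffOn_id
  transition := by
    rintro _ rfl _ rfl x -
    exact ⟨1, fun y _ => (one_smul _ _).symm⟩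

lemma projStructureEquiv_standard (hS : IsProjStructure S) :
    ProjStructureEquiv S (standardProjStructure 1) := by
  have hT := isProjStructure_standard
  refine ⟨?_, ?_, ?_, ?_⟩
  · rw [biUnion_union, hS.cover, univ_union]
  · rintro φ (hφ | hφ)
    exacts [hS.holo φ hφ, hT.holo φ hφ]
  · rintro φ (hφ | hφ)
    exacts [hS.holo_symm φ hφ, hT.holo_symm φ hφ]
  · rintro φ (hφ | hφ) ψ (hψ | hψ) x hx
    · exact hS.transition φ hφ ψ hψ x hx
    -- The identity is defined everywhere, so the overlap is the whole domain of `φ` and the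
    -- components coincide.
    · obtain rfl : ψ = _ := hψ
      obtain ⟨g, hg⟩ := exists_eq_smul_on_component hS hφ hx.1
      refine ⟨g, fun y hy => hg y ?_⟩
      simpa using hy
    · obtain rfl : φ = _ := hφ
      obtain ⟨g, hg⟩ := exists_eq_smul_on_component hS hψ hx.2
      refine ⟨g⁻¹, fun y hy => ?_⟩
      rw [hg y (by simpa using hy), inv_smul_smul]
      rfl
    · exact hT.transition φ hφ ψ hψ x hx

end CP

theorem mainTheorem11 :
    (∀ n : ℕ, 2 ≤ n →
      IsProjConnection (CP.standardProjConnection n) ∧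
      IsFlatProjConnection (CP.standardProjConnection n) ∧
      ∀ S : Set (LocalConn (Fin n → ℂ) (CP n)), IsProjConnection S →
        ProjConnectionEquiv S (CP.standardProjConnection n)) ∧
    (IsProjStructure (CP.standardProjStructure 1) ∧
      ∀ S : Set (OpenPartialHomeomorph (CP 1) (CP 1)), IsProjStructure S →
        ProjStructureEquiv S (CP.standardProjStructure 1)) :=
  ⟨fun _ _ => ⟨CP.isProjConnection_standard, CP.isFlatProjConnection_standard,
    fun _ => CP.projConnectionEquiv_standard⟩,
    CP.isProjStructure_standard, fun _ => CP.projStructureEquiv_standard⟩
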